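/- Let $M$ be a von Neumann algebra acting on a Hilbert space, with separable predual and with a faithful normal trace $\tau$, $\tau(1)=1$, and let $A\subset M$ be a maximal abelian von Neumann subalgebra. Fix a standard Borel space $Y$ with a probability measure $\nu$ and a $*$-isomorphism of $A$ with $L^\infty(Y,\nu)$, by which the two algebras are identified. Let $N_M(A)$ be the group of unitaries $u\in M$ with $uAu^*=A$, and write $S''$ for the bicommutant of a set $S$ of bounded operators. For $E,F\subset Y\times Y$ write $E\prec F$ if there is a $\nu$-null set $N\subset Y$ such that $E\setminus (N\times N)\subset F$, and $E\equiv F$ if $E\prec F$ and $F\prec E$. For a countable subgroup $H<N_M(A)$, let $\Theta^H$ be a homomorphism from $H$ to the group of Borel automorphisms of $Y$ that preserve the class of $\nu$, such that $u^*fu=f\circ\Theta^H_u$ $\nu$-almost everywhere for all $u\in H$ and $f\in A$, and let $$\mathcal N_H=\{(\Theta^H_u(t),t)\;:\;t\in Y,\ u\in H\}.$$ Then: 1. There is a countable subgroup $G<N_M(A)$ with $G''=N_M(A)''$. 2. For every countable subgroup $H<N_M(A)$ a homomorphism $\Theta^H$ as above exists. 3. Let $G<N_M(A)$ be a countable subgroup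 with $G''=N_M(A)''$ and let $H<N_M(A)$ be any countable subgroup. For every choice of $\Theta^G$ and $\Theta^H$ one has $\mathcal N_H\prec\mathcal N_G$; moreover $\mathcal N_H\equiv\mathcal N_G$ if and only if $\{H\cup A\}''=N_M(A)''$. -/

import Mathlib

open MeasureTheory
open scoped ComplexOrder

noncomputable section

section Operators

variable {H : Type*} [NormedAddCommGroup H] [InnerProductSpace ℂ H] [CompleteSpace H]

/-- The bicommutant `S''` of a set of bounded operators. -/
def bicommutant (S : Set (H →L[ℂ] H)) : Set (H →L[ℂ] H) :=
  Set.centralizer (Set.centralizer S)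

/-- A bounded functional on `M` is normal (ultraweakly continuous) if it has the form
`x ↦ ∑ₙ ⟪ξₙ, x ηₙ⟫` for square-summable sequences of vectors `ξ`, `η`. -/
def IsNormalFunctional {M : VonNeumannAlgebra H} (f : M.toStarSubalgebra →L[ℂ] ℂ) : Prop :=
  ∃ ξ η : ℕ → H, Summable (fun n => ‖ξ n‖ ^ 2) ∧ Summable (fun n => ‖η n‖ ^ 2) ∧
    ∀ x : M.toStarSubalgebra, f x = ∑' n, inner ℂ (ξ n) ((x : H →L[ℂ] H) (η n))

/-- The predual of `M`, that is, the set of normal functionals, is separable in norm. -/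
def HasSeparablePredual (M : VonNeumannAlgebra H) : Prop :=
  TopologicalSpace.IsSeparable
    {f : M.toStarSubalgebra →L[ℂ] ℂ | IsNormalFunctional f}

/-- `τ` is a faithful normal trace on `M` with `τ 1 = 1`. -/
structure IsFaithfulNormalTrace {M : VonNeumannAlgebra H}
    (τ : M.toStarSubalgebra →L[ℂ] ℂ) : Prop where
  map_one : τ 1 = 1
  nonneg : ∀ x, 0 ≤ τ (star x * x)
  faithful : ∀ x, τ (star x * x) = 0 → x = 0
  trace : ∀ x y, τ (x * y) = τ (y * x)
  normal : IsNormalFunctional τ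

/-- `A` is a maximal abelian von Neumann subalgebra (MASA) of `M`. -/
def IsMASA (A M : VonNeumannAlgebra H) : Prop :=
  Maximal (fun B : VonNeumannAlgebra H => B ≤ M ∧ ∀ x ∈ B, ∀ y ∈ B, x * y = y * x) A

/-- The normalizer `N_M(A)`: the group of unitaries `u ∈ M` with `u A u* = A`. -/
def normalizerIn (M A : VonNeumannAlgebra H) : Subgroup (unitary (H →L[ℂ] H)) where
  carrier := {u | (u : H →L[ℂ] H) ∈ M ∧
    (fun x => (u : H →L[ℂ] H) * x * star (u : H →L[ℂ] H)) '' (A : Set (H →L[ℂ] H)) = A}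
  one_mem' := ⟨by simp, by simp⟩
  mul_mem' := by
    rintro u v ⟨hu, hu'⟩ ⟨hv, hv'⟩
    refine ⟨by simpa using mul_mem hu hv, ?_⟩
    conv_rhs => rw [← hu', ← hv']
    rw [Set.image_image]
    refine Set.image_congr fun x _ => ?_
    simp [mul_assoc]
  inv_mem' := by
    rintro u ⟨hu, hu'⟩
    refine ⟨by simpa [← Unitary.star_eq_inv] using star_mem hu, ?_⟩
    conv_lhs => rw [← hu']
    rw [Set.image_image]
    have h (x : H →L[ℂ] H) : star (u : H →L[ℂ] H) *
        ((u : H →L[ℂ] H) * x * star (u : H →L[ℂ] H)) * (u : H →L[ℂ] H) = x := by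
      have h1 : star (u : H →L[ℂ] H) * (u : H →L[ℂ] H) = 1 := Unitary.coe_star_mul_self u
      calc _ = (star (u : H →L[ℂ] H) * (u : H →L[ℂ] H)) * x *
            (star (u : H →L[ℂ] H) * (u : H →L[ℂ] H)) := by simp only [mul_assoc]
        _ = x := by rw [h1, one_mul, mul_one]
    simp [← Unitary.star_eq_inv, h]

/-- The set of operators in a subgroup of the normalizer. -/
def opSet {M A : VonNeumannAlgebra H} (G : Subgroup (normalizerIn M A)) : Set (H →L[ℂ] H) :=
  {x | ∃ u ∈ G, ((u : unitary (H →L[ℂ] H)) : H →L[ℂ] H) = x}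

lemma normalizerIn.star_mul_mul_mem {M A : VonNeumannAlgebra H} (u : normalizerIn M A)
    (a : A.toStarSubalgebra) :
    star ((u : unitary (H →L[ℂ] H)) : H →L[ℂ] H) * (a : H →L[ℂ] H) *
      ((u : unitary (H →L[ℂ] H)) : H →L[ℂ] H) ∈ A.toStarSubalgebra := by
  have h := (u⁻¹).2.2
  have h2 := Set.mem_image_of_mem (fun x => (((u⁻¹ : normalizerIn M A) :
    unitary (H →L[ℂ] H)) : H →L[ℂ] H) * x * star (((u⁻¹ : normalizerIn M A) :
    unitary (H →L[ℂ] H)) : H →L[ℂ] H)) (show (a : H →L[ℂ] H) ∈ (A : Set (H →L[ℂ] H)) from a.2)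
  rw [h] at h2
  simpa [← Unitary.star_eq_inv] using h2

/-- For `u ∈ N_M(A)` and `a ∈ A`, the element `u* a u` of `A`. -/
def normalizerIn.conj {M A : VonNeumannAlgebra H} (u : normalizerIn M A)
    (a : A.toStarSubalgebra) : A.toStarSubalgebra :=
  ⟨star ((u : unitary (H →L[ℂ] H)) : H →L[ℂ] H) * (a : H →L[ℂ] H) *
    ((u : unitary (H →L[ℂ] H)) : H →L[ℂ] H), normalizerIn.star_mul_mul_mem u a⟩

end Operators

section MeasureSpace

variable {Y : Type*} [MeasurableSpace Y]

/-- The group of Borel automorphisms of `Y` that preserve the class of `ν`. -/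
def classPreservingAut (ν : Measure Y) : Subgroup (Equiv.Perm Y) where
  carrier := {e | Measure.QuasiMeasurePreserving e ν ν ∧
    Measure.QuasiMeasurePreserving e.symm ν ν}
  one_mem' := ⟨Measure.QuasiMeasurePreserving.id ν, Measure.QuasiMeasurePreserving.id ν⟩
  mul_mem' := fun ha hb => ⟨ha.1.comp hb.1, hb.2.comp ha.2⟩
  inv_mem' := fun ha => ⟨ha.2, ha.1⟩

/-- `E ≺ F`: there is a null set `N` with `E \ N² ⊆ F`. -/
def WeaklyContained (ν : Measure Y) (E F : Set (Y × Y)) : Prop :=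
  ∃ N : Set Y, ν N = 0 ∧ E \ (N ×ˢ N) ⊆ F

/-- `E ≡ F`: `E ≺ F` and `F ≺ E`. -/
def WeaklyEquivalent (ν : Measure Y) (E F : Set (Y × Y)) : Prop :=
  WeaklyContained ν E F ∧ WeaklyContained ν F E

/-- The orbit equivalence relation `{(Θ_u t, t)}` of an action by class-preserving
automorphisms. -/
def orbitRelation {ν : Measure Y} {K : Type*} [Group K] (Θ : K →* classPreservingAut ν) :
    Set (Y × Y) :=
  {p | ∃ (u : K) (t : Y), p = ((Θ u : Equiv.Perm Y) t, t)}

end MeasureSpace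

section Implementation

variable {H : Type*} [NormedAddCommGroup H] [InnerProductSpace ℂ H] [CompleteSpace H]
variable {Y : Type*} [MeasurableSpace Y]

/-- A `*`-isomorphism of `A` onto the von Neumann algebra `L^∞(Y, ν)`, whose elements are
multiplied and conjugated pointwise almost everywhere. -/
structure LInftyIso (A : VonNeumannAlgebra H) (ν : Measure Y) where
  toLinearEquiv : A.toStarSubalgebra ≃ₗ[ℂ] Lp ℂ ⊤ ν
  map_mul : ∀ a b, (toLinearEquiv (a * b) : Y → ℂ) =ᵐ[ν]
    fun t => (toLinearEquiv a : Y → ℂ) t * (toLinearEquiv b : Y → ℂ) t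
  map_star : ∀ a, (toLinearEquiv (star a) : Y → ℂ) =ᵐ[ν]
    fun t => star ((toLinearEquiv a : Y → ℂ) t)

/-- `Θ` is a homomorphism from a subgroup `K` of the normalizer to the class-preserving
automorphisms with `u* f u = f ∘ Θ_u` almost everywhere for all `u ∈ K` and `f ∈ A`, where
`A` is identified with `L^∞(Y, ν)` by `φ`. -/
def Implements {M A : VonNeumannAlgebra H} {ν : Measure Y} (φ : LInftyIso A ν)
    {K : Subgroup (normalizerIn M A)} (Θ : K →* classPreservingAut ν) : Prop :=
  ∀ (u : K) (f : A.toStarSubalgebra),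
    (φ.toLinearEquiv (normalizerIn.conj (u : normalizerIn M A) f) : Y → ℂ) =ᵐ[ν]
      fun t => (φ.toLinearEquiv f : Y → ℂ) ((Θ u : Equiv.Perm Y) t)

end Implementation

end

/-! Conjugation by a normalizing unitary is an automorphism of $A=L^\infty(Y,\nu)$, hence comes from
a point map of $Y$, unique up to null sets (`exists_realizes`, `Realizes.ae_eq`). For a countable
group the exceptional null sets can be removed all at once (`exists_classPreservingAut_ae_eq`),
which gives the action. Separability of the predual makes the normalizer separable in a topology
that detects commutation, whence a countable generating subgroup.

The comparison rests on two facts about $v=u^*g$ and a Borel set $B$. If the point map of $v$ fixes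
$B$ pointwise, then $v1_B$ commutes with $A$, so it lies in $A$ by maximality
(`IsMASA.op_mul_proj_mem`). If it moves every point of $B$, then $\tau(av1_B)=0$ for all $a\in A$
(`IsFaithfulNormalTrace.apply_eq_zero_of_forall_ne`).

Suppose the relation of $K$ weakly contains that of $G$. For $g\in G$, countably many sets $B_n$, on
each of which $g$ acts as some $u_n\in K$, cover $Y$ up to a null set. Then
$g1_{B_n}=u_n\cdot(u_n^*g1_{B_n})$ with the second factor in $A$, and normality of the projections
puts $g$ in $(K\cup A)''$.

Conversely, let $g\in(K\cup A)''$ and let $B$ be the set where $g$ acts like no $u\in K$. Then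
$y=g1_B$ lies in $(K\cup A)''$ but is $\tau$-orthogonal to every $ua$ with $u\in K$, $a\in A$. These
products form a self-adjoint monoid, so the double commutant theorem for the amplification, with
normality of $\tau$, gives $\tau(y^*y)=0$. Faithfulness makes $B$ null. -/

noncomputable section

/-! ### Bicommutants, amplification and normal functionals -/

section Bicommutant

variable {H : Type*} [NormedAddCommGroup H] [InnerProductSpace ℂ H]

lemma mem_bicommutant_iff {S : Set (H →L[ℂ] H)} {x : H →L[ℂ] H} :
    x ∈ bicommutant S ↔ ∀ T : H →L[ℂ] H, (∀ s ∈ S, s * T = T * s) → T * x = x * T := by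
  simp [bicommutant, Set.mem_centralizer_iff]

lemma subset_bicommutant (S : Set (H →L[ℂ] H)) : S ⊆ bicommutant S :=
  Set.subset_centralizer_centralizer

lemma bicommutant_mono {S T : Set (H →L[ℂ] H)} (h : S ⊆ T) : bicommutant S ⊆ bicommutant T :=
  Set.centralizer_subset (Set.centralizer_subset h)

lemma bicommutant_subset_iff {S T : Set (H →L[ℂ] H)} :
    bicommutant S ⊆ bicommutant T ↔ S ⊆ bicommutant T := by
  refine ⟨(subset_bicommutant S).trans, fun h => ?_⟩
  have h2 := bicommutant_mono h
  rwa [bicommutant, bicommutant, bicommutant, Set.centralizer_centralizer_centralizer] at h2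

lemma mul_mem_bicommutant {S : Set (H →L[ℂ] H)} {x y : H →L[ℂ] H} (hx : x ∈ bicommutant S)
    (hy : y ∈ bicommutant S) : x * y ∈ bicommutant S :=
  Set.mul_mem_centralizer hx hy

lemma memℓp_two_of_summable {E : Type*} [NormedAddCommGroup E] {ξ : ℕ → E}
    (h : Summable fun n => ‖ξ n‖ ^ 2) : Memℓp ξ 2 := by
  refine memℓp_gen ?_
  simpa using h

/-- The operator `x ⊗ 1` on `ℓ²(ℕ, H)`. -/
def amplify (x : H →L[ℂ] H) : lp (fun _ : ℕ => H) 2 →L[ℂ] lp (fun _ : ℕ => H) 2 :=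
  lp.mapCLM 2 (K := ‖x‖) (fun _ => x) (norm_nonneg x) (fun _ => le_rfl)

@[simp] lemma amplify_apply (x : H →L[ℂ] H) (ξ : lp (fun _ : ℕ => H) 2) (n : ℕ) :
    amplify x ξ n = x (ξ n) := rfl

lemma amplify_mul (x y : H →L[ℂ] H) : amplify (x * y) = amplify x * amplify y := by
  ext; rfl

/-- An operator on `ℓ²(ℕ, H)` commuting with the amplification of a set commutes with the
amplification of its bicommutant. -/
lemma commute_amplify_of_mem_bicommutant {S : Set (H →L[ℂ] H)} {x : H →L[ℂ] H}
    (hx : x ∈ bicommutant S) {P : lp (fun _ : ℕ => H) 2 →L[ℂ] lp (fun _ : ℕ => H) 2}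
    (hP : ∀ s ∈ S, amplify s * P = P * amplify s) : P * amplify x = amplify x * P := by
  -- Each matrix entry $P_{ij}$ commutes with `S`, hence with `x`.
  have key : ∀ i j, ∀ h : H, P (lp.single 2 j (x h)) i = x (P (lp.single 2 j h) i) := by
    intro i j h
    have := mem_bicommutant_iff.1 hx ((lp.evalCLM ℂ (fun _ : ℕ => H) 2 i) ∘L P ∘L
      (lp.singleContinuousLinearMap ℂ (fun _ : ℕ => H) 2 j)) (fun s hs => by
        ext h
        have h1 := congrArg (fun f : lp (fun _ : ℕ => H) 2 => f i)
          (DFunLike.congr_fun (hP s hs) (lp.single 2 j h))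
        have h2 : amplify s (lp.single 2 j h) = lp.single 2 j (s h) := by
          ext k
          by_cases hk : k = j
          · subst hk; simp
          · simp [hk]
        simp only [mul_apply_eq_comp, h2, amplify_apply] at h1
        simpa [lp.evalCLM] using h1)
    simpa [lp.evalCLM] using DFunLike.congr_fun this h
  ext ξ i
  have h1 := ((lp.hasSum_single (by simp) (amplify x ξ)).mapL P).mapL
    (lp.evalCLM ℂ (fun _ : ℕ => H) 2 i)
  have h2 := (((lp.hasSum_single (by simp) ξ).mapL P).mapL
    (lp.evalCLM ℂ (fun _ : ℕ => H) 2 i)).mapL x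
  refine h1.unique ?_
  convert! h2 using 1
  ext j
  simp [lp.evalCLM, key]

variable [CompleteSpace H]

lemma inner_amplify_left (x : H →L[ℂ] H) (ξ η : lp (fun _ : ℕ => H) 2) :
    inner ℂ (amplify x ξ) η = inner ℂ ξ (amplify (star x) η) := by
  simp only [lp.inner_eq_tsum, amplify_apply]
  simp [ContinuousLinearMap.star_eq_adjoint, ContinuousLinearMap.adjoint_inner_right]

/-- The double commutant theorem for the amplification of a self-adjoint monoid of operators. -/
lemma amplify_apply_mem_closure_span (S : Submonoid (H →L[ℂ] H)) (hS : ∀ s ∈ S, star s ∈ S)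
    {x : H →L[ℂ] H} (hx : x ∈ bicommutant (S : Set (H →L[ℂ] H))) (ξ : lp (fun _ : ℕ => H) 2) :
    amplify x ξ ∈ (Submodule.span ℂ ((fun s => amplify s ξ) '' S)).topologicalClosure := by
  set V := (Submodule.span ℂ ((fun s => amplify s ξ) '' S)).topologicalClosure with hV
  have hVc : IsClosed (V : Set (lp (fun _ : ℕ => H) 2)) :=
    Submodule.isClosed_topologicalClosure _
  have : CompleteSpace V := hVc.completeSpace_coe
  have hinv : ∀ s ∈ S, ∀ v ∈ V, amplify s v ∈ V := by
    intro s hs v hv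
    have : V ≤ V.comap (amplify s : lp (fun _ : ℕ => H) 2 →ₗ[ℂ] lp (fun _ : ℕ => H) 2) := by
      refine Submodule.topologicalClosure_minimal _ (Submodule.span_le.2 ?_)
        (hVc.preimage (amplify s).continuous)
      rintro _ ⟨t, ht, rfl⟩
      refine Submodule.le_topologicalClosure _ (Submodule.subset_span ⟨s * t, mul_mem hs ht, ?_⟩)
      simp [amplify_mul]
    exact this hv
  -- `V` is invariant under `S`, and so is its orthogonal complement since `S` is self-adjoint;
  -- hence the projection onto `V` commutes with the amplified `S`.
  have hcomm : ∀ s ∈ (S : Set (H →L[ℂ] H)),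
      amplify s * V.starProjection = V.starProjection * amplify s := by
    intro s hs
    ext1 v
    simp only [mul_apply_eq_comp]
    symm
    refine Submodule.eq_starProjection_of_mem_of_inner_eq_zero
      (hinv s hs _ (Submodule.starProjection_apply_mem _ _)) ?_
    intro w hw
    rw [← map_sub, inner_amplify_left]
    exact Submodule.starProjection_inner_eq_zero _ _ (hinv _ (hS s hs) w hw)
  have hξ : ξ ∈ V := Submodule.le_topologicalClosure _
    (Submodule.subset_span ⟨1, one_mem S, by ext; simp⟩)
  have := DFunLike.congr_fun (commute_amplify_of_mem_bicommutant hx hcomm) ξ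
  simp only [mul_apply_eq_comp, Submodule.starProjection_eq_self_iff.2 hξ] at this
  rw [← this]
  exact Submodule.starProjection_apply_mem _ _

/-- A normal functional vanishing on `s* y` for all `s` in a self-adjoint monoid vanishes on
`x* y` for all `x` in its bicommutant. -/
lemma IsNormalFunctional.apply_eq_zero_of_mem_bicommutant {M : VonNeumannAlgebra H}
    {f : M.toStarSubalgebra →L[ℂ] ℂ} (hf : IsNormalFunctional f)
    (S : Submonoid (H →L[ℂ] H)) (hS : ∀ s ∈ S, star s ∈ S) (y : M.toStarSubalgebra)
    (hSM : ∀ s ∈ S, s ∈ M.toStarSubalgebra)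
    (h0 : ∀ s (hs : s ∈ S), f (star (⟨s, hSM s hs⟩ : M.toStarSubalgebra) * y) = 0)
    (x : M.toStarSubalgebra) (hx : (x : H →L[ℂ] H) ∈ bicommutant (S : Set (H →L[ℂ] H))) :
    f (star x * y) = 0 := by
  obtain ⟨ξ, η, hξ, hη, hf⟩ := hf
  let ξ' : lp (fun _ : ℕ => H) 2 := ⟨ξ, memℓp_two_of_summable hξ⟩
  let η' : lp (fun _ : ℕ => H) 2 := ⟨η, memℓp_two_of_summable hη⟩
  -- On the amplification, `f` becomes a single vector functional, so orthogonality to the orbit of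
  -- `ξ'` passes to its closed span.
  have hform : ∀ z : M.toStarSubalgebra,
      f (star z * y) = inner ℂ (amplify (z : H →L[ℂ] H) ξ') (amplify (y : H →L[ℂ] H) η') := by
    intro z
    rw [hf, lp.inner_eq_tsum]
    congr 1
    ext n
    simp [ξ', η', ContinuousLinearMap.star_eq_adjoint, ContinuousLinearMap.adjoint_inner_right]
  rw [hform]
  have hmem := amplify_apply_mem_closure_span S hS hx ξ'
  have hle : (Submodule.span ℂ ((fun s => amplify s ξ') '' S)).topologicalClosure ≤
      (Submodule.span ℂ {amplify (y : H →L[ℂ] H) η'})ᗮ := by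
    refine Submodule.topologicalClosure_minimal _ (Submodule.span_le.2 ?_)
      (Submodule.isClosed_orthogonal _)
    rintro _ ⟨s, hs, rfl⟩
    rw [SetLike.mem_coe, Submodule.mem_orthogonal_singleton_iff_inner_left]
    rw [← h0 s hs, hform]
  exact Submodule.mem_orthogonal_singleton_iff_inner_left.1 (hle hmem)

/-- Normal functionals are continuous along bounded strongly convergent sequences. -/
lemma IsNormalFunctional.tendsto_of_strong {M : VonNeumannAlgebra H}
    {f : M.toStarSubalgebra →L[ℂ] ℂ} (hf : IsNormalFunctional f) {y : ℕ → M.toStarSubalgebra}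
    {z : M.toStarSubalgebra} {C : ℝ} (hC : ∀ n, ‖(y n : H →L[ℂ] H)‖ ≤ C)
    (h : ∀ v, Filter.Tendsto (fun n => (y n : H →L[ℂ] H) v) Filter.atTop
      (nhds ((z : H →L[ℂ] H) v))) :
    Filter.Tendsto (fun n => f (y n)) Filter.atTop (nhds (f z)) := by
  obtain ⟨ξ, η, hξ, hη, hf⟩ := hf
  simp only [hf]
  have hC0 : 0 ≤ C := (norm_nonneg _).trans (hC 0)
  refine tendsto_tsum_of_dominated_convergence (bound := fun k => C * (‖ξ k‖ ^ 2 + ‖η k‖ ^ 2))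
    ((hξ.add hη).mul_left C) (fun k => tendsto_const_nhds.inner (h (η k))) ?_
  refine Filter.Eventually.of_forall fun n k => ?_
  calc _ ≤ ‖ξ k‖ * ‖(y n : H →L[ℂ] H) (η k)‖ := norm_inner_le_norm _ _
    _ ≤ ‖ξ k‖ * (C * ‖η k‖) := by
      gcongr
      exact ((y n : H →L[ℂ] H).le_opNorm _).trans (by gcongr; exact hC n)
    _ ≤ C * (‖ξ k‖ ^ 2 + ‖η k‖ ^ 2) := by
      nlinarith [mul_nonneg hC0 (sq_nonneg (‖ξ k‖ - ‖η k‖)), mul_nonneg hC0 (sq_nonneg ‖ξ k‖),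
        mul_nonneg hC0 (sq_nonneg ‖η k‖)]

end Bicommutant

/-! ### Projections of $A$ as Borel sets -/

namespace LInftyIso

variable {H : Type*} [NormedAddCommGroup H] [InnerProductSpace ℂ H] [CompleteSpace H]
variable {A : VonNeumannAlgebra H} {Y : Type*} [MeasurableSpace Y] {ν : Measure Y}
variable (φ : LInftyIso A ν)

lemma eq_of_ae {a b : A.toStarSubalgebra}
    (h : (φ.toLinearEquiv a : Y → ℂ) =ᵐ[ν] φ.toLinearEquiv b) : a = b :=
  φ.toLinearEquiv.injective (Lp.ext h)

lemma exists_of_bounded {F : Y → ℂ} (hF : AEStronglyMeasurable F ν) (C : ℝ)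
    (hC : ∀ᵐ t ∂ν, ‖F t‖ ≤ C) :
    ∃ a, (φ.toLinearEquiv a : Y → ℂ) =ᵐ[ν] F :=
  ⟨φ.toLinearEquiv.symm ((memLp_top_of_bound hF C hC).toLp F), by
    rw [LinearEquiv.apply_symm_apply]; exact MemLp.coeFn_toLp _⟩

lemma map_add (a b : A.toStarSubalgebra) : (φ.toLinearEquiv (a + b) : Y → ℂ) =ᵐ[ν]
    fun t => φ.toLinearEquiv a t + φ.toLinearEquiv b t := by
  rw [_root_.map_add]; exact Lp.coeFn_add _ _

lemma map_sub (a b : A.toStarSubalgebra) : (φ.toLinearEquiv (a - b) : Y → ℂ) =ᵐ[ν]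
    fun t => φ.toLinearEquiv a t - φ.toLinearEquiv b t := by
  rw [_root_.map_sub]; exact Lp.coeFn_sub _ _

lemma map_smul (c : ℂ) (a : A.toStarSubalgebra) : (φ.toLinearEquiv (c • a) : Y → ℂ) =ᵐ[ν]
    fun t => c * φ.toLinearEquiv a t := by
  rw [_root_.map_smul]; exact Lp.coeFn_smul _ _

lemma map_one : (φ.toLinearEquiv 1 : Y → ℂ) =ᵐ[ν] fun _ => 1 := by
  obtain ⟨e, he⟩ := φ.exists_of_bounded (F := fun _ => 1) aestronglyMeasurable_const 1 (by simp)
  have h := φ.map_mul 1 e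
  rw [one_mul] at h
  filter_upwards [h, he] with t h1 h2
  rw [h2, mul_one] at h1
  exact h1.symm

lemma mul_comm (φ : LInftyIso A ν) (a b : A.toStarSubalgebra) : a * b = b * a := by
  apply φ.eq_of_ae
  filter_upwards [φ.map_mul a b, φ.map_mul b a] with t h1 h2
  rw [h1, h2, _root_.mul_comm]

lemma coe_mul_comm (φ : LInftyIso A ν) {a b : H →L[ℂ] H} (ha : a ∈ A.toStarSubalgebra)
    (hb : b ∈ A.toStarSubalgebra) : a * b = b * a :=
  congrArg Subtype.val (φ.mul_comm ⟨a, ha⟩ ⟨b, hb⟩)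

section Projections

variable [IsFiniteMeasure ν]

/-- The projection of `A` corresponding to the indicator function of `B`. -/
def proj (B : Set Y) : A.toStarSubalgebra :=
  φ.toLinearEquiv.symm
    -- The measurable hull lets `proj` accept any set without a measurability proof; for measurable
    -- `B` it changes only a null set.
    (indicatorConstLp ⊤ (measurableSet_toMeasurable ν B) (measure_ne_top ν _) 1)

lemma coe_proj {B : Set Y} (hB : MeasurableSet B) :
    (φ.toLinearEquiv (φ.proj B) : Y → ℂ) =ᵐ[ν] B.indicator fun _ => 1 := by
  rw [proj, LinearEquiv.apply_symm_apply]
  exact indicatorConstLp_coeFn.trans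
    (indicator_ae_eq_of_ae_eq_set hB.nullMeasurableSet.toMeasurable_ae_eq)

lemma proj_mul_proj {B C : Set Y} (hB : MeasurableSet B) (hC : MeasurableSet C) :
    φ.proj B * φ.proj C = φ.proj (B ∩ C) := by
  apply φ.eq_of_ae
  filter_upwards [φ.map_mul (φ.proj B) (φ.proj C), φ.coe_proj hB, φ.coe_proj hC,
    φ.coe_proj (hB.inter hC)] with t h1 h2 h3 h4
  rw [h1, h2, h3, h4]
  by_cases hb : t ∈ B <;> by_cases hc : t ∈ C <;> simp [hb, hc]

lemma proj_mul_self {B : Set Y} (hB : MeasurableSet B) : φ.proj B * φ.proj B = φ.proj B := by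
  rw [proj_mul_proj φ hB hB, Set.inter_self]

lemma proj_univ : φ.proj Set.univ = 1 := by
  apply φ.eq_of_ae
  filter_upwards [φ.map_one, φ.coe_proj MeasurableSet.univ] with t h1 h2
  rw [h1, h2]; simp

lemma star_proj {B : Set Y} (hB : MeasurableSet B) : star (φ.proj B) = φ.proj B := by
  apply φ.eq_of_ae
  filter_upwards [φ.map_star (φ.proj B), φ.coe_proj hB] with t h1 h2
  rw [h1, h2]
  by_cases hb : t ∈ B <;> simp [hb]

lemma proj_eq_proj_iff {B C : Set Y} (hB : MeasurableSet B) (hC : MeasurableSet C) :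
    φ.proj B = φ.proj C ↔ B =ᵐ[ν] C := by
  constructor
  · intro h
    have h1 := φ.coe_proj hB
    rw [h] at h1
    have h2 := h1.symm.trans (φ.coe_proj hC)
    filter_upwards [h2] with t ht
    have : t ∈ B ↔ t ∈ C := by
      by_cases hb : t ∈ B <;> by_cases hc : t ∈ C <;> simp_all
    exact propext this
  · intro h
    exact φ.eq_of_ae ((φ.coe_proj hB).trans ((indicator_ae_eq_of_ae_eq_set h).trans
      (φ.coe_proj hC).symm))

lemma proj_empty : φ.proj ∅ = 0 := by
  apply φ.eq_of_ae
  rw [map_zero]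
  filter_upwards [φ.coe_proj MeasurableSet.empty, Lp.coeFn_zero ℂ ⊤ ν] with t h1 h2
  rw [h1, h2]; simp

lemma proj_eq_zero_iff {B : Set Y} (hB : MeasurableSet B) : φ.proj B = 0 ↔ ν B = 0 := by
  rw [← φ.proj_empty, φ.proj_eq_proj_iff hB MeasurableSet.empty, ae_eq_empty]

lemma proj_mul_proj_eq_left_iff {B C : Set Y} (hB : MeasurableSet B) (hC : MeasurableSet C) :
    φ.proj B * φ.proj C = φ.proj B ↔ B ≤ᵐ[ν] C := by
  rw [φ.proj_mul_proj hB hC, φ.proj_eq_proj_iff (hB.inter hC) hB]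
  constructor <;> intro h <;> filter_upwards [h] with t ht
  · intro hb
    have : t ∈ B ∩ C ↔ t ∈ B := iff_of_eq ht
    exact (this.2 hb).2
  · exact propext (⟨fun h => h.1, fun h => ⟨h, ht h⟩⟩ : t ∈ B ∩ C ↔ t ∈ B)

lemma proj_union {B C : Set Y} (hB : MeasurableSet B) (hC : MeasurableSet C) :
    φ.proj (B ∪ C) = φ.proj B + φ.proj (C \ B) := by
  apply φ.eq_of_ae
  filter_upwards [φ.map_add (φ.proj B) (φ.proj (C \ B)), φ.coe_proj hB, φ.coe_proj (hC.diff hB),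
    φ.coe_proj (hB.union hC)] with t h1 h2 h3 h4
  rw [h1, h2, h3, h4]
  by_cases hb : t ∈ B <;> by_cases hc : t ∈ C <;> simp [hb, hc]

lemma proj_compl {B : Set Y} (hB : MeasurableSet B) : φ.proj Bᶜ = 1 - φ.proj B := by
  have := φ.proj_union hB MeasurableSet.univ
  rw [Set.union_univ, proj_univ, ← Set.compl_eq_univ_sdiff] at this
  rw [this]; abel

lemma exists_proj_eq {e : A.toStarSubalgebra} (he : e * e = e) :
    ∃ B, MeasurableSet B ∧ e = φ.proj B := by
  have hm : Measurable (φ.toLinearEquiv e : Y → ℂ) := (Lp.stronglyMeasurable _).measurable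
  have hB : MeasurableSet ((φ.toLinearEquiv e : Y → ℂ) ⁻¹' {1}) :=
    hm (measurableSet_singleton _)
  refine ⟨_, hB, φ.eq_of_ae ?_⟩
  have h := φ.map_mul e e
  rw [he] at h
  filter_upwards [h, φ.coe_proj hB] with t h1 h2
  rw [h2]
  have : φ.toLinearEquiv e t = 0 ∨ φ.toLinearEquiv e t = 1 := by
    have : φ.toLinearEquiv e t * (φ.toLinearEquiv e t - 1) = 0 := by
      rw [mul_sub, ← h1]; ring
    rcases mul_eq_zero.1 this with h | h
    · exact Or.inl h
    · exact Or.inr (sub_eq_zero.1 h)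
  rcases this with h | h <;> simp [h]

lemma isStarProjection_proj {B : Set Y} (hB : MeasurableSet B) :
    IsStarProjection (φ.proj B : H →L[ℂ] H) :=
  ⟨congrArg Subtype.val (φ.proj_mul_self hB), congrArg Subtype.val (φ.star_proj hB)⟩

lemma norm_proj_le {B : Set Y} (hB : MeasurableSet B) : ‖(φ.proj B : H →L[ℂ] H)‖ ≤ 1 :=
  (φ.isStarProjection_proj hB).norm_le

/-- The projections of an increasing sequence of sets converge strongly to the projection of
the union: `*`-isomorphisms of von Neumann algebras are normal. -/
lemma tendsto_proj {B : ℕ → Set Y} (hB : ∀ n, MeasurableSet (B n)) (hmono : Monotone B) (v : H) :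
    Filter.Tendsto (fun n => (φ.proj (B n) : H →L[ℂ] H) v) Filter.atTop
      (nhds ((φ.proj (⋃ n, B n) : H →L[ℂ] H) v)) := by
  set p : ℕ → H →L[ℂ] H := fun n => (φ.proj (B n) : H →L[ℂ] H) with hp
  have hpp : ∀ {m n}, m ≤ n → p n * p m = p m := by
    intro m n hmn
    have := φ.proj_mul_proj (hB n) (hB m)
    rw [Set.inter_eq_right.2 (hmono hmn)] at this
    exact congrArg Subtype.val this
  choose U hUo hU using fun n => isStarProjection_iff_eq_starProjection.1
    (φ.isStarProjection_proj (hB n))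
  have hUmono : Monotone U := by
    intro m n hmn x hx
    have h1 : p m x = x := by
      rw [hp]; simp only; rw [hU]; exact Submodule.starProjection_eq_self_iff.2 hx
    have h2 : p n x = x := by
      conv_lhs => rw [← h1]
      rw [← mul_apply_eq_comp, hpp hmn, h1]
    rw [hp] at h2; simp only at h2; rw [hU] at h2
    exact Submodule.starProjection_eq_self_iff.1 h2
  -- The strong limit of the projections. It commutes with the commutant of `A`, so it is some
  -- `φ.proj C`; it remains to see that `C` is the union up to a null set.
  set q : H →L[ℂ] H := (⨆ n, U n).topologicalClosure.starProjection with hq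
  have hlim : ∀ x, Filter.Tendsto (fun n => p n x) Filter.atTop (nhds (q x)) := by
    intro x
    have := Submodule.starProjection_tendsto_closure_iSup U hUmono x
    simpa only [hp, hU] using this
  have hqp : IsStarProjection q := isStarProjection_starProjection
  have hqA : q ∈ A := by
    rw [← VonNeumannAlgebra.commutant_commutant A, VonNeumannAlgebra.mem_commutant_iff]
    intro T hT
    ext x
    refine tendsto_nhds_unique ((T.continuous.tendsto _).comp (hlim x)) ?_
    have hc : ∀ n, T * p n = p n * T := fun n =>
      (VonNeumannAlgebra.mem_commutant_iff.1 hT (p n) (φ.proj (B n)).2).symm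
    refine (hlim (T x)).congr fun n => ?_
    rw [← mul_apply_eq_comp, ← hc]; rfl
  obtain ⟨C, hC, hqC⟩ := φ.exists_proj_eq (e := ⟨q, hqA⟩) (Subtype.ext hqp.1)
  have hqC' : q = (φ.proj C : H →L[ℂ] H) := congrArg Subtype.val hqC
  have hle : ∀ n, B n ≤ᵐ[ν] C := by
    intro n
    rw [← φ.proj_mul_proj_eq_left_iff (hB n) hC, φ.mul_comm]
    refine Subtype.ext (ContinuousLinearMap.ext fun x => ?_)
    change (φ.proj C : H →L[ℂ] H) (p n x) = p n x
    rw [← hqC']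
    refine tendsto_nhds_unique (hlim (p n x)) (tendsto_const_nhds.congr' ?_)
    filter_upwards [Filter.eventually_ge_atTop n] with m hm
    rw [← mul_apply_eq_comp, hpp hm]
  have hUm : MeasurableSet (⋃ n, B n) := MeasurableSet.iUnion hB
  have h1 : φ.proj (⋃ n, B n) * φ.proj C = φ.proj (⋃ n, B n) := by
    rw [φ.proj_mul_proj_eq_left_iff hUm hC]
    filter_upwards [ae_all_iff.2 hle] with t ht
    intro h
    obtain ⟨n, hn⟩ := Set.mem_iUnion.1 h
    exact ht n hn
  have h2 : φ.proj (⋃ n, B n) * φ.proj C = φ.proj C := by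
    refine Subtype.ext (ContinuousLinearMap.ext fun x => ?_)
    change (φ.proj (⋃ n, B n) : H →L[ℂ] H) ((φ.proj C : H →L[ℂ] H) x) = (φ.proj C : H →L[ℂ] H) x
    rw [← hqC']
    refine tendsto_nhds_unique (((φ.proj (⋃ n, B n) : H →L[ℂ] H).continuous.tendsto _).comp (hlim x)) ((hlim x).congr fun n => ?_)
    have := φ.proj_mul_proj hUm (hB n)
    rw [Set.inter_eq_right.2 (Set.subset_iUnion B n)] at this
    exact (DFunLike.congr_fun (congrArg Subtype.val this) x).symm
  rw [← h1, h2, ← hqC']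
  exact hlim v

/-- Finite unions follow by induction, splitting off the new part of each set; the countable union
is their strong limit. -/
lemma mul_proj_iUnion_eq_zero {B : ℕ → Set Y} (hB : ∀ n, MeasurableSet (B n)) {y : H →L[ℂ] H}
    (h : ∀ n, y * (φ.proj (B n) : H →L[ℂ] H) = 0) :
    y * (φ.proj (⋃ n, B n) : H →L[ℂ] H) = 0 := by
  have hm : ∀ n, MeasurableSet (Set.accumulate B n) := fun n => .biUnion (Set.to_countable _)
    fun k _ => hB k
  have hacc : ∀ n, y * (φ.proj (Set.accumulate B n) : H →L[ℂ] H) = 0 := by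
    intro n
    induction n with
    | zero => simpa using h 0
    | succ n ih =>
      rw [Set.accumulate_succ, φ.proj_union (hm n) (hB _)]
      have h1 : φ.proj (B (n + 1) \ Set.accumulate B n) =
          φ.proj (B (n + 1)) * φ.proj (B (n + 1) \ Set.accumulate B n) := by
        rw [φ.proj_mul_proj (hB _) ((hB _).diff (hm n)),
          Set.inter_eq_right.2 Set.sdiff_subset]
      rw [h1]
      push_cast
      rw [mul_add, ih, ← mul_assoc, h, zero_mul, add_zero]
  ext v
  have h1 := φ.tendsto_proj hm Set.monotone_accumulate v
  rw [Set.iUnion_accumulate] at h1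
  have h2 := (y.continuous.tendsto _).comp h1
  refine tendsto_nhds_unique h2 (tendsto_const_nhds.congr fun n => ?_)
  exact (DFunLike.congr_fun (hacc n) v).symm

end Projections

end LInftyIso

/-! ### From near-actions to actions -/

section Strictification

variable {Y : Type*} [MeasurableSpace Y] [StandardBorelSpace Y] {ν : Measure Y}

/-- A near-action of a countable group on a standard Borel space agrees almost everywhere with
an action by Borel automorphisms. -/
lemma exists_classPreservingAut_ae_eq {K : Type*} [Group K] [Countable K] (θ : K → Y → Y)
    (hθ : ∀ u, Measure.QuasiMeasurePreserving (θ u) ν ν) (h1 : θ 1 =ᵐ[ν] id)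
    (hmul : ∀ u w, θ (u * w) =ᵐ[ν] θ u ∘ θ w) :
    ∃ Θ : K →* classPreservingAut ν, ∀ u, ((Θ u : Equiv.Perm Y) : Y → Y) =ᵐ[ν] θ u := by
  classical
  -- The action laws hold on the conull set `X`, which need not be invariant. The points whose
  -- images under all `θ w` stay in `X` form the conull invariant set `Y₀`; outside it the action is
  -- replaced by the identity.
  set X : Set Y := {t | θ 1 t = t ∧ ∀ u w, θ (u * w) t = θ u (θ w t)} with hX
  have hXm : MeasurableSet X := by
    refine (measurableSet_eq_fun (hθ 1).measurable measurable_id).inter ?_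
    have : {t | ∀ u w, θ (u * w) t = θ u (θ w t)} = ⋂ u, ⋂ w, {t | θ (u * w) t = θ u (θ w t)} := by
      ext; simp
    change MeasurableSet {t | ∀ u w, θ (u * w) t = θ u (θ w t)}
    rw [this]
    exact .iInter fun u => .iInter fun w => measurableSet_eq_fun (hθ _).measurable
      ((hθ u).measurable.comp (hθ w).measurable)
  have hXae : ∀ᵐ t ∂ν, t ∈ X := by
    filter_upwards [h1, ae_all_iff.2 fun u => ae_all_iff.2 fun w => hmul u w] with t ht ht'
    exact ⟨ht, ht'⟩
  set Y₀ : Set Y := {t | t ∈ X ∧ ∀ w, θ w t ∈ X} with hY₀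
  have hY₀m : MeasurableSet Y₀ := by
    have : Y₀ = X ∩ ⋂ w, θ w ⁻¹' X := by ext; simp [hY₀]
    rw [this]
    exact hXm.inter (.iInter fun w => (hθ w).measurable hXm)
  have hY₀ae : ∀ᵐ t ∂ν, t ∈ Y₀ := by
    filter_upwards [hXae, ae_all_iff.2 fun w => (hθ w).ae hXae] with t ht ht'
    exact ⟨ht, ht'⟩
  have hinv : ∀ u, ∀ t ∈ Y₀, θ u t ∈ Y₀ := by
    rintro u t ⟨ht, ht'⟩
    exact ⟨ht' u, fun w => by rw [← ht.2]; exact ht' _⟩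
  set σ : K → Y → Y := fun u t => if t ∈ Y₀ then θ u t else t with hσ
  have hσ1 : ∀ t, σ 1 t = t := by
    intro t
    by_cases ht : t ∈ Y₀
    · simp [hσ, ht, ht.1.1]
    · simp [hσ, ht]
  have hσmul : ∀ u w t, σ (u * w) t = σ u (σ w t) := by
    intro u w t
    by_cases ht : t ∈ Y₀
    · simp [hσ, ht, hinv w t ht, ht.1.2]
    · simp [hσ, ht]
  have hσθ : ∀ u, σ u =ᵐ[ν] θ u := by
    intro u
    filter_upwards [hY₀ae] with t ht
    simp [hσ, ht]
  have hσq : ∀ u, Measure.QuasiMeasurePreserving (σ u) ν ν := by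
    intro u
    have hm : Measurable (σ u) := Measurable.ite hY₀m (hθ u).measurable measurable_id
    refine ⟨hm, ?_⟩
    rw [Measure.map_congr (hσθ u)]
    exact (hθ u).absolutelyContinuous
  let e : K → Equiv.Perm Y := fun u =>
    { toFun := σ u
      invFun := σ u⁻¹
      left_inv := fun t => by rw [← hσmul, inv_mul_cancel, hσ1]
      right_inv := fun t => by rw [← hσmul, mul_inv_cancel, hσ1] }
  refine ⟨{ toFun := fun u => ⟨e u, hσq u, hσq u⁻¹⟩, map_one' := ?_, map_mul' := ?_ }, hσθ⟩
  · exact Subtype.ext (Equiv.ext hσ1)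
  · intro u w
    exact Subtype.ext (Equiv.ext (hσmul u w))

end Strictification

/-! ### Point realization of automorphisms of $L^\infty(Y,\nu)$ -/

section Realization

variable {H : Type*} [NormedAddCommGroup H] [InnerProductSpace ℂ H] [CompleteSpace H]

/-- The `*`-homomorphism `a ↦ u* a u` of `A`. -/
def conjHom {M A : VonNeumannAlgebra H} (u : normalizerIn M A) :
    A.toStarSubalgebra →⋆ₐ[ℂ] A.toStarSubalgebra where
  toFun := normalizerIn.conj u
  map_one' := Subtype.ext (by simp [normalizerIn.conj])
  map_zero' := Subtype.ext (by simp [normalizerIn.conj])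
  map_add' a b := Subtype.ext (by simp [normalizerIn.conj, mul_add, add_mul])
  map_mul' a b := Subtype.ext (by
    have h1 : ((u : unitary (H →L[ℂ] H)) : H →L[ℂ] H) *
        star ((u : unitary (H →L[ℂ] H)) : H →L[ℂ] H) = 1 := Unitary.coe_mul_star_self _
    simp only [normalizerIn.conj, MulMemClass.coe_mul]
    simp only [mul_assoc]
    rw [← mul_assoc ((u : unitary (H →L[ℂ] H)) : H →L[ℂ] H) (star _), h1, one_mul])
  commutes' c := Subtype.ext (by
    have h1 : star ((u : unitary (H →L[ℂ] H)) : H →L[ℂ] H) *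
        ((u : unitary (H →L[ℂ] H)) : H →L[ℂ] H) = 1 := Unitary.coe_star_mul_self _
    simp [normalizerIn.conj, Algebra.algebraMap_eq_smul_one, h1])
  map_star' a := Subtype.ext (by simp [normalizerIn.conj, mul_assoc])

lemma coe_conjHom {M A : VonNeumannAlgebra H} (u : normalizerIn M A)
    (a : A.toStarSubalgebra) : (conjHom u a : H →L[ℂ] H) =
      star ((u : unitary (H →L[ℂ] H)) : H →L[ℂ] H) * (a : H →L[ℂ] H) *
      ((u : unitary (H →L[ℂ] H)) : H →L[ℂ] H) := rfl

lemma conjHom_mul {M A : VonNeumannAlgebra H} (u w : normalizerIn M A)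
    (a : A.toStarSubalgebra) : conjHom (u * w) a = conjHom w (conjHom u a) :=
  Subtype.ext (by simp [coe_conjHom, mul_assoc])

lemma conjHom_one {M A : VonNeumannAlgebra H} (a : A.toStarSubalgebra) :
    conjHom (1 : normalizerIn M A) a = a :=
  Subtype.ext (by simp [coe_conjHom])

lemma conjHom_inv_conjHom {M A : VonNeumannAlgebra H} (u : normalizerIn M A)
    (a : A.toStarSubalgebra) : conjHom u⁻¹ (conjHom u a) = a := by
  rw [← conjHom_mul, mul_inv_cancel, conjHom_one]

lemma conjHom_conjHom_inv {M A : VonNeumannAlgebra H} (u : normalizerIn M A)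
    (a : A.toStarSubalgebra) : conjHom u (conjHom u⁻¹ a) = a := by
  rw [← conjHom_mul, inv_mul_cancel, conjHom_one]

variable {M A : VonNeumannAlgebra H} {Y : Type*} [MeasurableSpace Y] {ν : Measure Y}
  (φ : LInftyIso A ν)

/-- The point map `θ` implements `a ↦ u* a u`. -/
def Realizes (u : normalizerIn M A) (θ : Y → Y) : Prop :=
  Measure.QuasiMeasurePreserving θ ν ν ∧
    ∀ f : A.toStarSubalgebra, (φ.toLinearEquiv (conjHom u f) : Y → ℂ) =ᵐ[ν]
      fun t => φ.toLinearEquiv f (θ t)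

variable {φ}

lemma Realizes.congr {u : normalizerIn M A} {θ θ' : Y → Y} (h : Realizes φ u θ)
    (hθ' : Measure.QuasiMeasurePreserving θ' ν ν) (hθ : θ' =ᵐ[ν] θ) : Realizes φ u θ' := by
  refine ⟨hθ', fun f => (h.2 f).trans ?_⟩
  filter_upwards [hθ] with t ht
  rw [ht]

lemma Realizes.mul {u w : normalizerIn M A} {θ ψ : Y → Y} (hu : Realizes φ u θ)
    (hw : Realizes φ w ψ) : Realizes φ (u * w) (θ ∘ ψ) := by
  refine ⟨hu.1.comp hw.1, fun f => ?_⟩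
  rw [conjHom_mul]
  exact (hw.2 _).trans (hw.1.ae (hu.2 f))

lemma realizes_one : Realizes φ (1 : normalizerIn M A) id :=
  ⟨Measure.QuasiMeasurePreserving.id ν, fun f => by rw [conjHom_one]; rfl⟩

section

variable [IsFiniteMeasure ν]

lemma Realizes.conjHom_proj {u : normalizerIn M A} {θ : Y → Y} (h : Realizes φ u θ)
    {B : Set Y} (hB : MeasurableSet B) : conjHom u (φ.proj B) = φ.proj (θ ⁻¹' B) :=
  φ.eq_of_ae (by
    filter_upwards [h.2 (φ.proj B), h.1.ae (φ.coe_proj hB), φ.coe_proj (h.1.measurable hB)]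
      with t h1 h2 h3
    rw [h1, h2, h3]; rfl)

/-- With $B=\{|g|\le r\}$, the bound is the algebraic identity $b^*b+g^*g1_B=r^21_B$, where
$b=\sqrt{r^2-|g|^2}\,1_B$. A $*$-homomorphism preserves such an identity, so no continuity of the
conjugation is needed. -/
lemma ae_norm_conjHom_le {u : normalizerIn M A} {θ : Y → Y}
    (hθ : Measure.QuasiMeasurePreserving θ ν ν)
    (h : ∀ B, MeasurableSet B → conjHom u (φ.proj B) = φ.proj (θ ⁻¹' B))
    (g : A.toStarSubalgebra) {r : ℝ} (hr : 0 ≤ r) :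
    ∀ᵐ t ∂ν, ‖φ.toLinearEquiv g (θ t)‖ ≤ r → ‖φ.toLinearEquiv (conjHom u g) t‖ ≤ r := by
  set F : Y → ℂ := ⇑(φ.toLinearEquiv g) with hF
  have hFm : Measurable F := (Lp.stronglyMeasurable _).measurable
  set B : Set Y := {t | ‖F t‖ ≤ r} with hBdef
  have hB : MeasurableSet B := measurableSet_le hFm.norm measurable_const
  have hroot : Measurable fun t => (Real.sqrt (r ^ 2 - ‖F t‖ ^ 2) : ℂ) :=
    Complex.measurable_ofReal.comp ((measurable_const.sub (hFm.norm.pow_const 2)).sqrt)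
  obtain ⟨b, hb⟩ := φ.exists_of_bounded (hroot.indicator hB).aestronglyMeasurable r (by
    refine Filter.Eventually.of_forall fun t => ?_
    by_cases ht : t ∈ B
    · rw [Set.indicator_of_mem ht, Complex.norm_real, Real.norm_of_nonneg (Real.sqrt_nonneg _)]
      exact Real.sqrt_le_iff.2 ⟨hr, by nlinarith [sq_nonneg ‖F t‖]⟩
    · rw [Set.indicator_of_notMem ht]; simpa using hr)
  have hrel : star b * b + star g * g * φ.proj B = ((r : ℂ) ^ 2) • φ.proj B := by
    apply φ.eq_of_ae
    filter_upwards [hb, φ.map_add (star b * b) (star g * g * φ.proj B), φ.map_mul (star b) b,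
      φ.map_star b, φ.map_mul (star g * g) (φ.proj B), φ.map_mul (star g) g, φ.map_star g,
      φ.map_smul ((r : ℂ) ^ 2) (φ.proj B), φ.coe_proj hB] with t e1 e2 e3 e4 e5 e6 e7 e8 e9
    rw [e2, e3, e4, e5, e6, e7, e8, e9, e1, ← hF]
    by_cases ht : t ∈ B
    · have h0 : 0 ≤ r ^ 2 - ‖F t‖ ^ 2 := by
        have : ‖F t‖ ≤ r := ht
        nlinarith [norm_nonneg (F t)]
      simp only [Set.indicator_of_mem ht, mul_one]
      have e : star (F t) * F t = ((‖F t‖ ^ 2 : ℝ) : ℂ) := by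
        rw [RCLike.star_def, RCLike.conj_mul]; simp
      rw [e, RCLike.star_def, Complex.conj_ofReal, ← Complex.ofReal_mul, Real.mul_self_sqrt h0]
      push_cast; ring
    · simp [ht]
  have hrel2 := congrArg (conjHom u) hrel
  simp only [map_add, map_mul, map_star, map_smul, h B hB] at hrel2
  set G := conjHom u g with hG
  set c := conjHom u b with hc
  have hcoe := φ.coe_proj (hθ.measurable hB)
  filter_upwards [φ.map_add (star c * c) (star G * G * φ.proj (θ ⁻¹' B)), φ.map_mul (star c) c,
    φ.map_star c, φ.map_mul (star G * G) (φ.proj (θ ⁻¹' B)), φ.map_mul (star G) G, φ.map_star G,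
    φ.map_smul ((r : ℂ) ^ 2) (φ.proj (θ ⁻¹' B)), hcoe] with t e2 e3 e4 e5 e6 e7 e8 e9 ht
  have ht' : t ∈ θ ⁻¹' B := ht
  rw [hrel2, e8, e3, e4, e5, e6, e7, e9, Set.indicator_of_mem ht', mul_one, mul_one] at e2
  have e : ∀ z : ℂ, star z * z = ((‖z‖ ^ 2 : ℝ) : ℂ) := by
    intro z; rw [RCLike.star_def, RCLike.conj_mul]; simp
  rw [e, e] at e2
  have e' : r ^ 2 = ‖φ.toLinearEquiv c t‖ ^ 2 + ‖φ.toLinearEquiv G t‖ ^ 2 := by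
    exact_mod_cast e2
  exact abs_le_of_sq_le_sq' (by nlinarith [sq_nonneg ‖φ.toLinearEquiv c t‖]) hr |>.2

/-- Applying the norm bound to $f-c$, for $c$ in a countable dense set and rational radii, shows
that almost everywhere $u^*fu$ at $t$ lies in every such closed disc that contains $f(\theta t)$;
the two values then agree. -/
lemma realizes_of_conjHom_proj {u : normalizerIn M A} {θ : Y → Y}
    (hθ : Measure.QuasiMeasurePreserving θ ν ν)
    (h : ∀ B, MeasurableSet B → conjHom u (φ.proj B) = φ.proj (θ ⁻¹' B)) : Realizes φ u θ := by
  refine ⟨hθ, fun f => ?_⟩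
  obtain ⟨D, hDc, hDd⟩ := TopologicalSpace.exists_countable_dense ℂ
  have key : ∀ c ∈ D, ∀ r : ℚ, ∀ᵐ t ∂ν, 0 ≤ (r : ℝ) → ‖φ.toLinearEquiv f (θ t) - c‖ ≤ r →
      ‖φ.toLinearEquiv (conjHom u f) t - c‖ ≤ r := by
    intro c _ r
    by_cases hr : 0 ≤ (r : ℝ)
    swap
    · exact Filter.Eventually.of_forall fun t h => absurd h hr
    have e1 : ∀ a : A.toStarSubalgebra, (φ.toLinearEquiv (a - c • 1) : Y → ℂ) =ᵐ[ν]
        fun t => φ.toLinearEquiv a t - c := by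
      intro a
      filter_upwards [φ.map_sub a (c • 1), φ.map_smul c 1, φ.map_one] with t h1 h2 h3
      rw [h1, h2, h3, mul_one]
    have e2 : conjHom u (f - c • 1) = conjHom u f - c • 1 := by
      rw [map_sub, map_smul, map_one]
    have e3 := ae_norm_conjHom_le hθ h (f - c • 1) hr
    rw [e2] at e3
    filter_upwards [e3, hθ.ae (e1 f), e1 (conjHom u f)] with t h1 h2 h3 _
    rwa [h2, h3] at h1
  have key2 : ∀ᵐ t ∂ν, ∀ c ∈ D, ∀ r : ℚ, 0 ≤ (r : ℝ) → ‖φ.toLinearEquiv f (θ t) - c‖ ≤ r →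
      ‖φ.toLinearEquiv (conjHom u f) t - c‖ ≤ r :=
    (ae_ball_iff hDc).2 fun c hc => ae_all_iff.2 fun r => key c hc r
  filter_upwards [key2] with t ht
  refine eq_of_forall_dist_le fun ε hε => ?_
  obtain ⟨r, hr0, hrε⟩ := exists_rat_btwn (half_pos hε)
  obtain ⟨c, hc, hcd⟩ := hDd.exists_dist_lt (φ.toLinearEquiv f (θ t)) hr0
  rw [dist_eq_norm] at hcd
  have := ht c hc r hr0.le hcd.le
  calc _ ≤ dist (φ.toLinearEquiv (conjHom u f) t) c + dist c (φ.toLinearEquiv f (θ t)) :=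
        dist_triangle _ _ _
    _ ≤ r + r := by
      rw [dist_comm c, dist_eq_norm, dist_eq_norm]; exact add_le_add this hcd.le
    _ ≤ ε := by linarith

/-- An automorphism preserves the order of projections, hence countable suprema. One inequality
comes from `u`, the other from its inverse. -/
lemma conjHom_proj_iUnion (u : normalizerIn M A) {B C : ℕ → Set Y}
    (hB : ∀ n, MeasurableSet (B n)) (hC : ∀ n, MeasurableSet (C n))
    (h : ∀ n, conjHom u (φ.proj (B n)) = φ.proj (C n)) :
    conjHom u (φ.proj (⋃ n, B n)) = φ.proj (⋃ n, C n) := by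
  have hBU := MeasurableSet.iUnion hB
  have hCU := MeasurableSet.iUnion hC
  have hsub : ∀ {D : ℕ → Set Y} {E : Set Y}, (∀ n, MeasurableSet (D n)) → MeasurableSet E →
      (∀ n, φ.proj (D n) * φ.proj E = φ.proj (D n)) →
      φ.proj (⋃ n, D n) * φ.proj E = φ.proj (⋃ n, D n) := by
    intro D E hD hE hDE
    rw [φ.proj_mul_proj_eq_left_iff (.iUnion hD) hE]
    filter_upwards [ae_all_iff.2 fun n =>
      (φ.proj_mul_proj_eq_left_iff (hD n) hE).1 (hDE n)] with t ht hmem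
    obtain ⟨n, hn⟩ := Set.mem_iUnion.1 hmem
    exact ht n hn
  have hself : ∀ {D : ℕ → Set Y}, (∀ n, MeasurableSet (D n)) → ∀ n,
      φ.proj (D n) * φ.proj (⋃ n, D n) = φ.proj (D n) := by
    intro D hD n
    rw [φ.proj_mul_proj (hD n) (.iUnion hD), Set.inter_eq_left.2 (Set.subset_iUnion D n)]
  obtain ⟨D, hD, hD'⟩ := φ.exists_proj_eq (e := conjHom u (φ.proj (⋃ n, B n)))
    (by rw [← map_mul, φ.proj_mul_self hBU])
  obtain ⟨E, hE, hE'⟩ := φ.exists_proj_eq (e := conjHom u⁻¹ (φ.proj (⋃ n, C n)))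
    (by rw [← map_mul, φ.proj_mul_self hCU])
  have h1 : φ.proj (⋃ n, C n) * φ.proj D = φ.proj (⋃ n, C n) := by
    refine hsub hC hD fun n => ?_
    rw [← hD', ← h, ← map_mul, hself hB]
  have h2 : φ.proj (⋃ n, B n) * φ.proj E = φ.proj (⋃ n, B n) := by
    refine hsub hB hE fun n => ?_
    have : φ.proj (B n) = conjHom u⁻¹ (φ.proj (C n)) := by
      rw [← h, conjHom_inv_conjHom]
    rw [← hE', this, ← map_mul, hself hC]
  have h3 := congrArg (conjHom u) h2
  rw [map_mul, ← hE', conjHom_conjHom_inv, φ.mul_comm, hD', h1] at h3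
  rw [hD', h3]

variable [StandardBorelSpace Y]

/-- Preimages of each set of a countable separating family agree almost everywhere, since both
represent the same projection. -/
lemma Realizes.ae_eq {u : normalizerIn M A} {θ θ' : Y → Y} (h : Realizes φ u θ)
    (h' : Realizes φ u θ') : θ =ᵐ[ν] θ' := by
  have hS := fun n => MeasurableSpace.measurableSet_natGeneratingSequence (α := Y) n
  have : ∀ n, θ ⁻¹' (MeasurableSpace.natGeneratingSequence Y n) =ᵐ[ν]
      θ' ⁻¹' (MeasurableSpace.natGeneratingSequence Y n) := by
    intro n
    rw [← φ.proj_eq_proj_iff (h.1.measurable (hS n)) (h'.1.measurable (hS n)),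
      ← h.conjHom_proj (hS n), h'.conjHom_proj (hS n)]
  filter_upwards [ae_all_iff.2 this] with t ht
  apply MeasurableSpace.injective_mapNatBool Y
  classical
  ext n
  have h1 : (θ t ∈ MeasurableSpace.natGeneratingSequence Y n) =
    (θ' t ∈ MeasurableSpace.natGeneratingSequence Y n) := ht n
  simp only [MeasurableSpace.mapNatBool, h1]

/-- Automorphisms of `L^∞` of a standard Borel space are implemented by point maps. -/
lemma exists_realizes [Nonempty Y] (φ : LInftyIso A ν) (u : normalizerIn M A) :
    ∃ θ, Realizes φ u θ := by
  classical
  have hS := fun n => MeasurableSpace.measurableSet_natGeneratingSequence (α := Y) n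
  choose C hC hCe using fun n => φ.exists_proj_eq
    (e := conjHom u (φ.proj (MeasurableSpace.natGeneratingSequence Y n)))
    (by rw [← map_mul, φ.proj_mul_self (hS n)])
  -- `e` codes a point by the generating sets containing it; `g` uses their images `C n` under
  -- conjugation instead. The desired map is $e^{-1}\circ g$. By Lusin–Souslin the injective Borel
  -- map `e` is a measurable embedding.
  set e : Y → ℕ → Bool := MeasurableSpace.mapNatBool Y with he
  have hem : MeasurableEmbedding e := (MeasurableSpace.measurable_mapNatBool Y).measurableEmbedding
    (MeasurableSpace.injective_mapNatBool Y)
  set g : Y → ℕ → Bool := fun t n => decide (t ∈ C n) with hg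
  have hgpre : ∀ n, (fun t => g t n) ⁻¹' {true} = C n := by intro n; ext t; simp [hg]
  have hepre : ∀ n, (fun t => e t n) ⁻¹' {true} = MeasurableSpace.natGeneratingSequence Y n := by
    intro n; ext t; simp [he, MeasurableSpace.mapNatBool]
  have hgm : Measurable g := by
    refine measurable_pi_lambda _ fun n => measurable_to_bool ?_
    rw [hgpre]; exact hC n
  have hall : ∀ D, MeasurableSet D → conjHom u (φ.proj (e ⁻¹' D)) = φ.proj (g ⁻¹' D) := by
    intro E hE
    -- The good sets form a σ-algebra containing the coordinate cylinders.
    let m' : MeasurableSpace (ℕ → Bool) :=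
      { MeasurableSet' := fun D => MeasurableSet[MeasurableSpace.pi] D ∧
          conjHom u (φ.proj (e ⁻¹' D)) = φ.proj (g ⁻¹' D)
        measurableSet_empty := ⟨MeasurableSet.empty, by simp [φ.proj_empty]⟩
        measurableSet_compl := fun D hD => ⟨hD.1.compl, by
          rw [Set.preimage_compl, Set.preimage_compl, φ.proj_compl (hem.measurable hD.1),
            φ.proj_compl (hgm hD.1), map_sub, map_one, hD.2]⟩
        measurableSet_iUnion := fun D hD => ⟨MeasurableSet.iUnion fun n => (hD n).1, by
          rw [Set.preimage_iUnion, Set.preimage_iUnion]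
          exact conjHom_proj_iUnion u (fun n => hem.measurable (hD n).1)
            (fun n => hgm (hD n).1) fun n => (hD n).2⟩ }
    have hle : MeasurableSpace.pi ≤ m' := by
      refine iSup_le fun n => ?_
      rw [← measurable_iff_comap_le]
      refine measurable_to_bool ⟨measurable_pi_apply n (measurableSet_singleton true), ?_⟩
      change conjHom u (φ.proj ((fun t => e t n) ⁻¹' {true})) =
        φ.proj ((fun t => g t n) ⁻¹' {true})
      rw [hepre, hgpre, hCe]
    exact (hle E hE).2
  have hrange : ∀ᵐ t ∂ν, g t ∈ Set.range e := by
    have h1 := hall _ hem.measurableSet_range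
    rw [Set.preimage_range, φ.proj_univ, map_one, ← φ.proj_univ,
      φ.proj_eq_proj_iff MeasurableSet.univ (hgm hem.measurableSet_range)] at h1
    filter_upwards [h1] with t ht
    exact (iff_of_eq ht).1 trivial
  -- `k` is a Borel left inverse of `e`; its values off the range of `e` matter only on a null set,
  -- by `hrange`.
  obtain ⟨k, hk, hke⟩ := hem.exists_measurable_extend measurable_id (fun _ => inferInstance)
  have hθm : Measurable (k ∘ g) := hk.comp hgm
  have hpre : ∀ B, MeasurableSet B → conjHom u (φ.proj B) = φ.proj (k ∘ g ⁻¹' B) := by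
    intro B hB
    have h1 := hall _ (hem.measurableSet_image' hB)
    rw [Set.preimage_image_eq _ hem.injective] at h1
    rw [h1, φ.proj_eq_proj_iff (hgm (hem.measurableSet_image' hB)) (hθm hB)]
    filter_upwards [hrange] with t ⟨y, hy⟩
    have hy' : k (g t) = y := by rw [← hy]; exact congrFun hke y
    refine propext (?_ : g t ∈ e '' B ↔ k (g t) ∈ B)
    rw [hy', ← hy, hem.injective.mem_set_image]
  refine ⟨k ∘ g, realizes_of_conjHom_proj ⟨hθm, ?_⟩ hpre⟩
  refine Measure.AbsolutelyContinuous.mk fun B hB h0 => ?_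
  rw [Measure.map_apply hθm hB]
  rw [← φ.proj_eq_zero_iff (hθm hB), ← hpre B hB, (φ.proj_eq_zero_iff hB).2 h0, map_zero]

lemma exists_implements [Nonempty Y] (φ : LInftyIso A ν) (K : Subgroup (normalizerIn M A))
    [Countable K] : ∃ Θ : K →* classPreservingAut ν, Implements φ Θ := by
  choose θ hθ using fun u : K => exists_realizes φ (u : normalizerIn M A)
  obtain ⟨Θ, hΘ⟩ := exists_classPreservingAut_ae_eq θ (fun u => (hθ u).1)
    ((hθ 1).ae_eq realizes_one) (fun u w => (hθ (u * w)).ae_eq ((hθ u).mul (hθ w)))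
  exact ⟨Θ, fun u f => ((hθ u).congr (Θ u).2.1 (hΘ u)).2 f⟩

end

end Realization

/-! ### Consequences of maximality, and unitaries of $A$ -/

section MASA

variable {H : Type*} [NormedAddCommGroup H] [InnerProductSpace ℂ H] [CompleteSpace H]

/-- The von Neumann algebra generated by a self-adjoint set of operators. -/
def vonNeumannClosure (S : Set (H →L[ℂ] H)) (hS : ∀ s ∈ S, star s ∈ S) : VonNeumannAlgebra H where
  carrier := bicommutant S
  mul_mem' := Set.mul_mem_centralizer
  one_mem' := Set.one_mem_centralizer
  add_mem' := Set.add_mem_centralizer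
  zero_mem' := Set.zero_mem_centralizer
  algebraMap_mem' c := fun T _ => (Algebra.commutes c T).symm
  star_mem' := fun h => Set.star_mem_centralizer' (fun _ ha => Set.star_mem_centralizer' hS ha) h
  centralizer_centralizer' := Set.centralizer_centralizer_centralizer _

lemma bicommutant_coe (M : VonNeumannAlgebra H) :
    bicommutant (M : Set (H →L[ℂ] H)) = M := VonNeumannAlgebra.centralizer_centralizer M

/-- The von Neumann algebra generated by `A` and `x` is abelian and contained in `M`, so maximality
forces it into `A`. -/
lemma IsMASA.mem_of_isSelfAdjoint {A M : VonNeumannAlgebra H} (hA : IsMASA A M) {x : H →L[ℂ] H}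
    (hx : x ∈ M) (hsa : star x = x) (hcomm : ∀ a ∈ A, a * x = x * a) : x ∈ A := by
  set S : Set (H →L[ℂ] H) := insert x (A : Set (H →L[ℂ] H)) with hSdef
  have hS : ∀ s ∈ S, star s ∈ S := by
    rintro s (rfl | hs)
    · rw [hsa]; exact Set.mem_insert _ _
    · exact Set.mem_insert_of_mem _ (star_mem (S := VonNeumannAlgebra H) hs)
  have hSc : S ⊆ Set.centralizer S := by
    rintro s (rfl | hs) t (rfl | ht)
    · rfl
    · exact hcomm t ht
    · exact (hcomm s hs).symm
    · exact hA.prop.2 t ht s hs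
  have hSM : S ⊆ (M : Set (H →L[ℂ] H)) := by
    rintro s (rfl | hs)
    · exact hx
    · exact hA.prop.1 hs
  have hle : A ≤ vonNeumannClosure S hS := fun a ha =>
    subset_bicommutant S (Set.mem_insert_of_mem _ ha)
  refine hA.le_of_ge ⟨?_, ?_⟩ hle (subset_bicommutant S (Set.mem_insert _ _))
  · intro y hy
    have := bicommutant_mono hSM hy
    rwa [bicommutant_coe] at this
  · intro y hy z hz
    exact hz y (Set.centralizer_subset hSc hy)

lemma IsMASA.mem_of_commute {A M : VonNeumannAlgebra H} (hA : IsMASA A M) {x : H →L[ℂ] H}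
    (hx : x ∈ M) (hcomm : ∀ a ∈ A, a * x = x * a) : x ∈ A := by
  have hxs : star x ∈ M := star_mem hx
  have hcs : ∀ a ∈ A, a * star x = star x * a := by
    intro a ha
    have := congrArg star (hcomm (star a) (star_mem ha))
    simpa using this.symm
  have h1 : x + star x ∈ A := hA.mem_of_isSelfAdjoint (add_mem hx hxs)
    (by simp [add_comm]) (fun a ha => by rw [mul_add, add_mul, hcomm a ha, hcs a ha])
  have h2 : Complex.I • (x - star x) ∈ A := by
    refine hA.mem_of_isSelfAdjoint (M.toStarSubalgebra.smul_mem (sub_mem hx hxs) _) ?_ ?_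
    · rw [star_smul, star_sub, star_star, RCLike.star_def, Complex.conj_I, neg_smul, ← smul_neg,
        neg_sub]
    · intro a ha
      rw [mul_smul_comm, smul_mul_assoc, mul_sub, sub_mul, hcomm a ha, hcs a ha]
  have h3 : x = (1 / 2 : ℂ) • ((x + star x) - Complex.I • (Complex.I • (x - star x))) := by
    rw [smul_smul, Complex.I_mul_I]; module
  rw [h3]
  exact A.toStarSubalgebra.smul_mem
    (sub_mem h1 (A.toStarSubalgebra.smul_mem h2 _)) _

lemma opSet_mono {M A : VonNeumannAlgebra H} {G K : Subgroup (normalizerIn M A)} (h : G ≤ K) :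
    opSet G ⊆ opSet K := fun _ ⟨u, hu, hx⟩ => ⟨u, h hu, hx⟩

/-- An abelian von Neumann algebra is generated by its unitaries, which normalize it. -/
lemma subset_bicommutant_opSet_top {A M : VonNeumannAlgebra H} (hAM : A ≤ M)
    (hcomm : ∀ x ∈ A, ∀ y ∈ A, x * y = y * x) :
    (A : Set (H →L[ℂ] H)) ⊆ bicommutant (opSet (⊤ : Subgroup (normalizerIn M A))) := by
  have hclosed : IsClosed (A.toStarSubalgebra : Set (H →L[ℂ] H)) := by
    have : (A.toStarSubalgebra : Set (H →L[ℂ] H)) =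
        Set.centralizer (Set.centralizer (A : Set (H →L[ℂ] H))) :=
      (VonNeumannAlgebra.centralizer_centralizer A).symm
    rw [this]
    exact Set.isClosed_centralizer _
  intro a ha
  rw [mem_bicommutant_iff]
  intro T hT
  have hmem : (⟨a, ha⟩ : A.toStarSubalgebra) ∈
      Submodule.span ℂ (unitary A.toStarSubalgebra : Set A.toStarSubalgebra) := by
    rw [CStarAlgebra.span_unitary]; trivial
  have hspan : ∀ b ∈ Submodule.span ℂ (unitary A.toStarSubalgebra : Set A.toStarSubalgebra),
      T * (b : H →L[ℂ] H) = b * T := by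
    intro b hb
    induction hb using Submodule.span_induction with
    | mem u hu =>
      have hu' : (u : H →L[ℂ] H) ∈ unitary (H →L[ℂ] H) :=
        ⟨congrArg Subtype.val hu.1, congrArg Subtype.val hu.2⟩
      -- A unitary of `A` fixes `A` pointwise under conjugation, so it belongs to the normalizer.
      refine (hT u ⟨⟨⟨u, hu'⟩, hAM u.2, ?_⟩, trivial, rfl⟩).symm
      have hfix : ∀ x ∈ A, (u : H →L[ℂ] H) * x * star (u : H →L[ℂ] H) = x := by
        intro x hx
        rw [hcomm _ u.2 x hx, mul_assoc, hu'.2, mul_one]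
      ext x
      constructor
      · rintro ⟨y, hy, rfl⟩
        simp only [hfix y hy]
        exact hy
      · intro hx
        exact ⟨x, hx, hfix x hx⟩
    | zero => simp
    | add x y _ _ hx hy => push_cast; rw [mul_add, add_mul, hx, hy]
    | smul c x _ hx =>
      change T * (c • (x : H →L[ℂ] H)) = (c • (x : H →L[ℂ] H)) * T
      rw [mul_smul_comm, smul_mul_assoc, hx]
  exact hspan _ hmem

end MASA

/-! ### A countable generating subgroup -/

section SeparablePredual

variable {H : Type*} [NormedAddCommGroup H] [InnerProductSpace ℂ H] [CompleteSpace H]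

/-- The vector functional `x ↦ ⟪ξ, x η⟫`. -/
def vectorFunctional (M : VonNeumannAlgebra H) (ξ η : H) : M.toStarSubalgebra →L[ℂ] ℂ where
  toFun x := inner ℂ ξ ((x : H →L[ℂ] H) η)
  map_add' x y := by simp
  map_smul' c x := by simp
  cont := by fun_prop

lemma vectorFunctional_apply (M : VonNeumannAlgebra H) (ξ η : H) (x : M.toStarSubalgebra) :
    vectorFunctional M ξ η x = inner ℂ ξ ((x : H →L[ℂ] H) η) := rfl

lemma isNormalFunctional_vectorFunctional (M : VonNeumannAlgebra H) (ξ η : H) :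
    IsNormalFunctional (vectorFunctional M ξ η) := by
  refine ⟨fun n => if n = 0 then ξ else 0, fun n => if n = 0 then η else 0, ?_, ?_, ?_⟩
  · exact summable_of_ne_finset_zero (s := {0}) (fun n hn => by simp_all)
  · exact summable_of_ne_finset_zero (s := {0}) (fun n hn => by simp_all)
  · intro x
    rw [tsum_eq_single 0 (fun n hn => by simp [hn])]
    rfl

/-- In a von Neumann algebra with separable predual, a countable subgroup of the normalizer
generates the same von Neumann algebra as the whole normalizer. -/
lemma exists_countable_bicommutant_eq {M A : VonNeumannAlgebra H} (hM : HasSeparablePredual M) :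
    ∃ G : Subgroup (normalizerIn M A), Countable G ∧
      bicommutant (opSet G) = bicommutant (opSet (⊤ : Subgroup (normalizerIn M A))) := by
  obtain ⟨c, hc, hcd⟩ := hM
  have : Countable c := hc.to_subtype
  let toM : normalizerIn M A → M.toStarSubalgebra := fun u => ⟨u, u.2.1⟩
  have hnorm : ∀ u, ‖toM u‖ ≤ 1 := fun u => by
    change ‖((u : unitary (H →L[ℂ] H)) : H →L[ℂ] H)‖ ≤ 1
    exact ContinuousLinearMap.opNorm_le_bound _ zero_le_one fun v => by
      rw [one_mul, ContinuousLinearMap.norm_map_of_mem_unitary (u : unitary (H →L[ℂ] H)).2]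
  -- The topology induced by countably many functionals is second countable, hence separable.
  -- Unitaries have norm at most one, so every vector functional is a uniform limit of these
  -- functionals and is continuous too.
  let ev : normalizerIn M A → c → ℂ := fun u f => f.1 (toM u)
  let top : TopologicalSpace (normalizerIn M A) := TopologicalSpace.induced ev inferInstance
  have : SecondCountableTopology (normalizerIn M A) :=
    TopologicalSpace.secondCountableTopology_induced _ _ ev
  obtain ⟨U, hUc, hUd⟩ := TopologicalSpace.exists_countable_dense (normalizerIn M A)
  have hev : Continuous ev := continuous_induced_dom
  have hcont : ∀ ξ η : H, Continuous fun u => vectorFunctional M ξ η (toM u) := by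
    intro ξ η
    refine continuous_of_uniform_approx_of_continuous fun s hs => ?_
    obtain ⟨ε, hε, hεs⟩ := Metric.mem_uniformity_dist.1 hs
    obtain ⟨f, hf, hfd⟩ := Metric.mem_closure_iff.1
      (hcd (isNormalFunctional_vectorFunctional M ξ η)) ε hε
    refine ⟨fun u => f (toM u), (continuous_apply (⟨f, hf⟩ : c)).comp hev, fun u => hεs ?_⟩
    rw [dist_eq_norm] at hfd ⊢
    rw [← sub_apply]
    refine lt_of_le_of_lt ((ContinuousLinearMap.le_opNorm _ _).trans
      (mul_le_of_le_one_right (norm_nonneg _) (hnorm u))) hfd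
  have : Countable U := hUc.to_subtype
  have hcount : Countable (Subgroup.closure U) := by
    rw [FreeGroup.closure_eq_range]
    exact (FreeGroup.lift ((↑) : U → normalizerIn M A)).rangeRestrict_surjective.countable
  refine ⟨Subgroup.closure U, hcount, ?_⟩
  refine (bicommutant_mono (opSet_mono le_top)).antisymm (bicommutant_subset_iff.2 ?_)
  rintro _ ⟨u, -, rfl⟩
  rw [mem_bicommutant_iff]
  intro T hT
  ext η
  refine ext_inner_left ℂ fun ξ => ?_
  -- Commuting with `T` is an equality of two vector functionals, so it extends from the dense set
  -- `U` to the whole normalizer.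
  have hU : ∀ w ∈ U, vectorFunctional M (star T ξ) η (toM w) =
      vectorFunctional M ξ (T η) (toM w) := by
    intro w hw
    have := hT _ ⟨w, Subgroup.subset_closure hw, rfl⟩
    rw [vectorFunctional_apply, vectorFunctional_apply, ContinuousLinearMap.star_eq_adjoint,
      ContinuousLinearMap.adjoint_inner_left]
    exact congrArg (inner ℂ ξ) (DFunLike.congr_fun this η).symm
  have := Continuous.ext_on hUd (hcont (star T ξ) η) (hcont ξ (T η)) hU
  have := congrFun this u
  rw [vectorFunctional_apply, vectorFunctional_apply, ContinuousLinearMap.star_eq_adjoint,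
      ContinuousLinearMap.adjoint_inner_left] at this
  exact this

end SeparablePredual

/-! ### Orbit relations up to null sets -/

section Relations

variable {Y : Type*} [MeasurableSpace Y] {ν : Measure Y}

lemma mem_orbitRelation {K : Type*} [Group K] {Θ : K →* classPreservingAut ν} {s t : Y} :
    (s, t) ∈ orbitRelation Θ ↔ ∃ u : K, (Θ u : Equiv.Perm Y) t = s := by
  constructor
  · rintro ⟨u, t', h⟩
    obtain ⟨rfl, rfl⟩ := Prod.mk.inj h
    exact ⟨u, rfl⟩
  · rintro ⟨u, rfl⟩
    exact ⟨u, t, rfl⟩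

/-- For the orbit relation of a countable group, weak containment can be tested almost
everywhere on each group element. -/
lemma weaklyContained_orbitRelation_iff {K : Type*} [Group K] [Countable K]
    {Θ : K →* classPreservingAut ν} {F : Set (Y × Y)} :
    WeaklyContained ν (orbitRelation Θ) F ↔
      ∀ u : K, ∀ᵐ t ∂ν, ((Θ u : Equiv.Perm Y) t, t) ∈ F := by
  constructor
  · rintro ⟨N, hN, h⟩ u
    filter_upwards [measure_eq_zero_iff_ae_notMem.1 hN] with t ht
    exact h ⟨⟨u, t, rfl⟩, fun hmem => ht hmem.2⟩
  · intro h
    have hN : ∀ᵐ t ∂ν, ∀ u : K, ((Θ u : Equiv.Perm Y) t, t) ∈ F := ae_all_iff.2 h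
    have hN' : ∀ᵐ t ∂ν, ∀ v u : K,
        ((Θ u : Equiv.Perm Y) ((Θ v : Equiv.Perm Y) t), (Θ v : Equiv.Perm Y) t) ∈ F :=
      ae_all_iff.2 fun v => (Θ v).2.1.ae hN
    -- The exceptional set is invariant: it consists of the points whose orbit meets a failure. A
    -- pair outside $N\times N$ has a good coordinate, and either coordinate reaches the second one,
    -- by `u⁻¹` or by `1`.
    refine ⟨{t | ¬ ∀ v u : K,
        ((Θ u : Equiv.Perm Y) ((Θ v : Equiv.Perm Y) t), (Θ v : Equiv.Perm Y) t) ∈ F}, hN', ?_⟩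
    rintro _ ⟨⟨u, t, rfl⟩, hnot⟩
    by_contra hF
    have key : ∀ s : Y, ∀ v w : K, (Θ (v * w) : Equiv.Perm Y) s =
        (Θ v : Equiv.Perm Y) ((Θ w : Equiv.Perm Y) s) := fun s v w => by rw [map_mul]; rfl
    refine hnot ⟨fun hgood => hF ?_, fun hgood => hF ?_⟩
    · have := hgood u⁻¹ u
      dsimp only at this
      rwa [← key, ← key, mul_inv_cancel, one_mul, ← key, inv_mul_cancel, map_one] at this
    · have := hgood 1 u
      dsimp only at this
      rwa [← key, mul_one, map_one] at this

/-- Adding complements to a separating sequence makes the separation one-sided: the first point is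
inside, the second outside. -/
lemma exists_separating_sequence (Y : Type*) [MeasurableSpace Y] [StandardBorelSpace Y] :
    ∃ S : ℕ → Set Y, (∀ n, MeasurableSet (S n)) ∧ ∀ x y, x ≠ y → ∃ n, x ∈ S n ∧ y ∉ S n := by
  classical
  set S₀ := MeasurableSpace.natGeneratingSequence Y with hS₀
  have hm : ∀ n, MeasurableSet (S₀ n) := MeasurableSpace.measurableSet_natGeneratingSequence
  let S : ℕ ⊕ ℕ → Set Y := Sum.elim S₀ fun n => (S₀ n)ᶜ
  have hS : ∀ x y, x ≠ y → ∃ i, x ∈ S i ∧ y ∉ S i := by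
    intro x y hxy
    by_contra! hcon
    refine hxy (MeasurableSpace.injective_mapNatBool Y (funext fun n => ?_))
    have h1 : x ∈ S₀ n → y ∈ S₀ n := hcon (Sum.inl n)
    have h2 : x ∉ S₀ n → y ∉ S₀ n := hcon (Sum.inr n)
    have h3 : (x ∈ S₀ n) = (y ∈ S₀ n) := propext ⟨h1, fun hy => by_contra fun hx => h2 hx hy⟩
    simp only [MeasurableSpace.mapNatBool]
    simp only [← hS₀, h3]
  have hSm : ∀ i, MeasurableSet (S i) := by
    rintro (k | k)
    · exact hm k
    · exact (hm k).compl
  refine ⟨fun n => S (Equiv.natSumNatEquivNat.symm n), fun n => hSm _, fun x y hxy => ?_⟩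
  obtain ⟨i, hi⟩ := hS x y hxy
  exact ⟨Equiv.natSumNatEquivNat i, by simpa only [Equiv.symm_apply_apply] using hi⟩

end Relations

/-! ### Orbit relations versus generated von Neumann algebras -/

section Comparison

variable {H : Type*} [NormedAddCommGroup H] [InnerProductSpace ℂ H] [CompleteSpace H]
  {M A : VonNeumannAlgebra H} {Y : Type*} [MeasurableSpace Y] {ν : Measure Y}
  {φ : LInftyIso A ν}

/-- The operator underlying an element of the normalizer. -/
abbrev normalizerIn.op (u : normalizerIn M A) : H →L[ℂ] H :=
  ((u : unitary (H →L[ℂ] H)) : H →L[ℂ] H)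

lemma star_op_mul_op (u : normalizerIn M A) : star (normalizerIn.op u) * normalizerIn.op u = 1 :=
  Unitary.coe_star_mul_self _

lemma op_mul_star_op (u : normalizerIn M A) : normalizerIn.op u * star (normalizerIn.op u) = 1 :=
  Unitary.coe_mul_star_self _

lemma coe_mul_op (u : normalizerIn M A) (a : A.toStarSubalgebra) :
    (a : H →L[ℂ] H) * normalizerIn.op u = normalizerIn.op u * (conjHom u a : H →L[ℂ] H) := by
  rw [coe_conjHom, ← mul_assoc, ← mul_assoc, op_mul_star_op, one_mul]

lemma Implements.realizes {K : Subgroup (normalizerIn M A)} {Θ : K →* classPreservingAut ν}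
    (h : Implements φ Θ) (u : K) :
    Realizes φ (u : normalizerIn M A) (Θ u : Equiv.Perm Y) := ⟨(Θ u).2.1, h u⟩

lemma Implements.realizes_inv_mul {K L : Subgroup (normalizerIn M A)}
    {ΘK : K →* classPreservingAut ν} {ΘL : L →* classPreservingAut ν} (hK : Implements φ ΘK)
    (hL : Implements φ ΘL) (u : K) (w : L) : Realizes φ ((u : normalizerIn M A)⁻¹ * (w : normalizerIn M A))
      (fun t => (ΘK u : Equiv.Perm Y).symm ((ΘL w : Equiv.Perm Y) t)) := by
  have h1 := (hK.realizes u⁻¹).mul (hL.realizes w)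
  rw [map_inv] at h1
  exact h1

variable [IsFiniteMeasure ν]

/-- If `v` acts without fixed points on `B` then `v 1_B` is orthogonal to `A`. -/
lemma IsFaithfulNormalTrace.apply_eq_zero_of_forall_ne [StandardBorelSpace Y]
    {τ : M.toStarSubalgebra →L[ℂ] ℂ} (hτ : IsFaithfulNormalTrace τ) (hAM : A ≤ M)
    {v : normalizerIn M A} {θ : Y → Y} (hv : Realizes φ v θ) {B : Set Y} (hB : MeasurableSet B)
    (hne : ∀ t ∈ B, θ t ≠ t) (a : A.toStarSubalgebra) (x : M.toStarSubalgebra)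
    (hx : (x : H →L[ℂ] H) = a * (normalizerIn.op v * (φ.proj B : H →L[ℂ] H))) : τ x = 0 := by
  obtain ⟨P, hP⟩ : ∃ P : Set Y → M.toStarSubalgebra,
      ∀ D, (P D : H →L[ℂ] H) = (φ.proj D : H →L[ℂ] H) :=
    ⟨fun D => ⟨φ.proj D, hAM (φ.proj D).2⟩, fun _ => rfl⟩
  obtain ⟨w, hw⟩ : ∃ w : M.toStarSubalgebra, (w : H →L[ℂ] H) = a * normalizerIn.op v :=
    ⟨⟨a, hAM a.2⟩ * ⟨normalizerIn.op v, v.2.1⟩, rfl⟩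
  have hxw : x = w * P B := Subtype.ext (by rw [hx, MulMemClass.coe_mul, hw, hP, mul_assoc])
  -- With $p=1_D$ and $D\cap\theta^{-1}D=\emptyset$, one has $pwp=0$, and the trace property gives
  -- $\tau(wp)=\tau(pwp)$.
  have hdisj : ∀ D, MeasurableSet D → (∀ t ∈ D, θ t ∉ D) → τ (w * P D) = 0 := by
    intro D hD hDθ
    have h1 : P D * P D = P D := Subtype.ext (by
      rw [MulMemClass.coe_mul, hP]
      exact congrArg Subtype.val (φ.proj_mul_self hD))
    have h2 : P D * (w * P D) = 0 := by
      refine Subtype.ext ?_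
      rw [MulMemClass.coe_mul, MulMemClass.coe_mul, hP, hw, ZeroMemClass.coe_zero]
      have h3 : conjHom v (φ.proj D) * φ.proj D = 0 := by
        rw [hv.conjHom_proj hD, φ.proj_mul_proj (hv.1.measurable hD) hD, ← φ.proj_empty]
        congr 1
        ext t
        simpa using fun h1 h2 => hDθ t h2 h1
      calc _ = ((φ.proj D : H →L[ℂ] H) * (a : H →L[ℂ] H)) * normalizerIn.op v *
              (φ.proj D : H →L[ℂ] H) := by simp only [mul_assoc]
        _ = (a : H →L[ℂ] H) * ((φ.proj D : H →L[ℂ] H) * normalizerIn.op v) *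
              (φ.proj D : H →L[ℂ] H) := by
            rw [φ.coe_mul_comm (φ.proj D).2 a.2]; simp only [mul_assoc]
        _ = (a : H →L[ℂ] H) * (normalizerIn.op v *
              ((conjHom v (φ.proj D) * φ.proj D : A.toStarSubalgebra) : H →L[ℂ] H)) := by
            rw [coe_mul_op]; push_cast; simp only [mul_assoc]
        _ = 0 := by rw [h3]; simp
    calc τ (w * P D) = τ (w * P D * P D) := by rw [mul_assoc, h1]
      _ = τ (P D * (w * P D)) := hτ.trace _ _
      _ = 0 := by rw [h2, map_zero]
  obtain ⟨S, hS, hSsep⟩ := exists_separating_sequence Y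
  -- On `D n` the point is in `S n` and its image is not, so `D n` is moved off itself. These sets
  -- cover `B` because `θ` has no fixed point there.
  set D : ℕ → Set Y := fun n => B ∩ S n ∩ (θ ⁻¹' (S n))ᶜ with hDdef
  have hD : ∀ n, MeasurableSet (D n) := fun n =>
    (hB.inter (hS n)).inter (hv.1.measurable (hS n)).compl
  have hDU : ⋃ n, D n = B := by
    ext t
    simp only [Set.mem_iUnion]
    constructor
    · rintro ⟨n, hn⟩; exact hn.1.1
    · intro ht
      obtain ⟨n, h1, h2⟩ := hSsep t (θ t) (hne t ht).symm
      exact ⟨n, ⟨ht, h1⟩, h2⟩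
  have hm : ∀ n, MeasurableSet (Set.accumulate D n) := fun n => .biUnion (Set.to_countable _)
    fun k _ => hD k
  have hacc : ∀ n, τ (w * P (Set.accumulate D n)) = 0 := by
    intro n
    induction n with
    | zero =>
      rw [Set.accumulate_zero_nat]
      exact hdisj _ (hD 0) fun t ht ht' => ht.2 ht'.1.2
    | succ n ih =>
      have h1 : P (Set.accumulate D (n + 1)) =
          P (Set.accumulate D n) + P (D (n + 1) \ Set.accumulate D n) := by
        refine Subtype.ext ?_
        rw [AddMemClass.coe_add, hP, hP, hP, Set.accumulate_succ, φ.proj_union (hm n) (hD _)]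
        rfl
      rw [h1, mul_add, map_add, ih, zero_add]
      exact hdisj _ ((hD _).diff (hm n)) fun t ht ht' => ht.1.2 ht'.1.1.2
  have hlim := hτ.normal.tendsto_of_strong (y := fun n => w * P (Set.accumulate D n))
    (z := w * P B) (C := ‖(w : H →L[ℂ] H)‖) (fun n => by
      rw [MulMemClass.coe_mul, hP]
      refine (norm_mul_le _ _).trans ?_
      exact mul_le_of_le_one_right (norm_nonneg _) (φ.norm_proj_le (hm n)))
    (fun v => by
      have h1 := φ.tendsto_proj hm Set.monotone_accumulate v
      rw [Set.iUnion_accumulate, hDU] at h1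
      simp only [MulMemClass.coe_mul, hP]
      exact ((w : H →L[ℂ] H).continuous.tendsto _).comp h1)
  rw [hxw]
  exact tendsto_nhds_unique hlim (tendsto_const_nhds.congr fun n => (hacc n).symm)

/-- The monoid of products of elements of `K` and of `A`. -/
def groupMulAlgebra (K : Subgroup (normalizerIn M A)) : Submonoid (H →L[ℂ] H) where
  carrier := {x | ∃ u ∈ K, ∃ a : A.toStarSubalgebra, x = normalizerIn.op u * a}
  one_mem' := ⟨1, one_mem K, 1, by simp [normalizerIn.op]⟩
  mul_mem' := by
    rintro _ _ ⟨u, hu, a, rfl⟩ ⟨w, hw, b, rfl⟩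
    refine ⟨u * w, mul_mem hu hw, conjHom w a * b, ?_⟩
    calc _ = normalizerIn.op u * ((a : H →L[ℂ] H) * normalizerIn.op w) * b := by
          simp only [mul_assoc]
      _ = _ := by rw [coe_mul_op]; push_cast; simp only [normalizerIn.op, mul_assoc]; rfl

lemma star_mem_groupMulAlgebra {K : Subgroup (normalizerIn M A)} {x : H →L[ℂ] H}
    (hx : x ∈ groupMulAlgebra K) : star x ∈ groupMulAlgebra K := by
  obtain ⟨u, hu, a, rfl⟩ := hx
  refine ⟨u⁻¹, inv_mem hu, conjHom u⁻¹ (star a), ?_⟩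
  rw [← coe_mul_op, star_mul]
  rfl

lemma subset_groupMulAlgebra (K : Subgroup (normalizerIn M A)) :
    opSet K ∪ (A : Set (H →L[ℂ] H)) ⊆ groupMulAlgebra K := by
  rintro x (⟨u, hu, rfl⟩ | hx)
  · exact ⟨u, hu, 1, by simp⟩
  · exact ⟨1, one_mem K, ⟨x, hx⟩, by simp [normalizerIn.op]⟩

/-- If `K` and `A` generate everything that the normalizer generates, then the orbit relation of
`K` weakly contains the one of every countable subgroup of the normalizer. -/
lemma weaklyContained_of_subset_bicommutant [StandardBorelSpace Y]
    {τ : M.toStarSubalgebra →L[ℂ] ℂ} (hτ : IsFaithfulNormalTrace τ) (hAM : A ≤ M)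
    {K L : Subgroup (normalizerIn M A)} [Countable K] [Countable L]
    {ΘK : K →* classPreservingAut ν} {ΘL : L →* classPreservingAut ν} (hK : Implements φ ΘK)
    (hL : Implements φ ΘL)
    (hgen : opSet (⊤ : Subgroup (normalizerIn M A)) ⊆
      bicommutant (opSet K ∪ (A : Set (H →L[ℂ] H)))) :
    WeaklyContained ν (orbitRelation ΘL) (orbitRelation ΘK) := by
  rw [weaklyContained_orbitRelation_iff]
  intro g
  -- The points that `g` sends outside their `K`-orbit; on this set every $u^{-1}g$ with $u\in K$
  -- acts without fixed points.
  set B : Set Y := ⋂ u : K, {t | (ΘK u : Equiv.Perm Y) t = (ΘL g : Equiv.Perm Y) t}ᶜ with hBdef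
  have hB : MeasurableSet B := .iInter fun u =>
    (measurableSet_eq_fun (ΘK u).2.1.measurable (ΘL g).2.1.measurable).compl
  suffices h0 : φ.proj B = 0 by
    have h1 := measure_eq_zero_iff_ae_notMem.1 ((φ.proj_eq_zero_iff hB).1 h0)
    filter_upwards [h1] with t ht
    rw [mem_orbitRelation]
    simpa [hBdef] using ht
  let y : M.toStarSubalgebra := ⟨normalizerIn.op (g : normalizerIn M A), g.1.2.1⟩ *
    ⟨φ.proj B, hAM (φ.proj B).2⟩
  have hyS : (y : H →L[ℂ] H) ∈ bicommutant (groupMulAlgebra K : Set (H →L[ℂ] H)) := by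
    have hsub := bicommutant_mono (subset_groupMulAlgebra K)
    exact mul_mem_bicommutant (hsub (hgen ⟨g, trivial, rfl⟩))
      (hsub (subset_bicommutant _ (Or.inr (φ.proj B).2)))
  have hSM : ∀ s ∈ groupMulAlgebra K, s ∈ M.toStarSubalgebra := by
    rintro _ ⟨u, -, a, rfl⟩
    exact mul_mem u.2.1 (hAM a.2)
  have hyy : τ (star y * y) = 0 := by
    refine hτ.normal.apply_eq_zero_of_mem_bicommutant (groupMulAlgebra K)
      (fun s => star_mem_groupMulAlgebra) y hSM ?_ y hyS
    rintro _ ⟨u, hu, a, rfl⟩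
    refine hτ.apply_eq_zero_of_forall_ne hAM (hK.realizes_inv_mul hL ⟨u, hu⟩ g) hB ?_ (star a) _ ?_
    · intro t ht heq
      rw [Equiv.symm_apply_eq] at heq
      exact Set.mem_iInter.1 ht ⟨u, hu⟩ heq.symm
    · change star (normalizerIn.op u * (a : H →L[ℂ] H)) *
        (normalizerIn.op (g : normalizerIn M A) * (φ.proj B : H →L[ℂ] H)) = star (a : H →L[ℂ] H) *
        (star (normalizerIn.op u) * normalizerIn.op (g : normalizerIn M A) *
          (φ.proj B : H →L[ℂ] H))
      rw [star_mul]; simp only [mul_assoc]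
  have hy0 := congrArg Subtype.val (hτ.faithful y hyy)
  refine Subtype.ext ?_
  calc (φ.proj B : H →L[ℂ] H) = star (normalizerIn.op (g : normalizerIn M A)) *
        (normalizerIn.op (g : normalizerIn M A) * (φ.proj B : H →L[ℂ] H)) := by
        rw [← mul_assoc, star_op_mul_op, one_mul]
    _ = 0 := by
        change normalizerIn.op (g : normalizerIn M A) * (φ.proj B : H →L[ℂ] H) = 0 at hy0
        rw [hy0, mul_zero]

/-- If `v ∈ N_M(A)` fixes the points of `B` then `v 1_B ∈ A`. -/
lemma IsMASA.op_mul_proj_mem (hA : IsMASA A M) {v : normalizerIn M A} {θ : Y → Y}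
    (hv : Realizes φ v θ) {B : Set Y} (hB : MeasurableSet B) (hfix : ∀ t ∈ B, θ t = t) :
    normalizerIn.op v * (φ.proj B : H →L[ℂ] H) ∈ A := by
  refine hA.mem_of_commute (mul_mem v.2.1 (hA.prop.1 (φ.proj B).2)) fun a ha => ?_
  have h1 : conjHom v ⟨a, ha⟩ * φ.proj B = φ.proj B * ⟨a, ha⟩ := by
    apply φ.eq_of_ae
    filter_upwards [φ.map_mul (conjHom v ⟨a, ha⟩) (φ.proj B), φ.map_mul (φ.proj B) ⟨a, ha⟩,
      φ.coe_proj hB, hv.2 ⟨a, ha⟩] with t h1 h2 h3 h4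
    rw [h1, h2, h3, h4]
    by_cases ht : t ∈ B
    · simp [ht, hfix t ht]
    · simp [ht]
  calc a * (normalizerIn.op v * (φ.proj B : H →L[ℂ] H))
      = (a * normalizerIn.op v) * (φ.proj B : H →L[ℂ] H) := by rw [mul_assoc]
    _ = normalizerIn.op v * ((conjHom v ⟨a, ha⟩ * φ.proj B : A.toStarSubalgebra) : H →L[ℂ] H) := by
        rw [coe_mul_op v ⟨a, ha⟩]; push_cast; rw [mul_assoc]
    _ = normalizerIn.op v * (φ.proj B : H →L[ℂ] H) * a := by
        rw [h1]; push_cast; rw [mul_assoc]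

/-- If the orbit relation of `K` weakly contains the one of `G`, then `K` and `A` generate `G`. -/
lemma opSet_subset_bicommutant_of_weaklyContained [StandardBorelSpace Y] (hA : IsMASA A M)
    {K G : Subgroup (normalizerIn M A)} [Countable K] [Countable G]
    {ΘK : K →* classPreservingAut ν} {ΘG : G →* classPreservingAut ν} (hK : Implements φ ΘK)
    (hG : Implements φ ΘG) (h : WeaklyContained ν (orbitRelation ΘG) (orbitRelation ΘK)) :
    opSet G ⊆ bicommutant (opSet K ∪ (A : Set (H →L[ℂ] H))) := by
  rintro _ ⟨g, hg, rfl⟩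
  rw [mem_bicommutant_iff]
  intro T hT
  obtain ⟨e, he⟩ := exists_surjective_nat K
  set B : ℕ → Set Y := fun n => {t | (ΘK (e n) : Equiv.Perm Y) t = (ΘG ⟨g, hg⟩ : Equiv.Perm Y) t}
    with hBdef
  have hB : ∀ n, MeasurableSet (B n) := fun n =>
    measurableSet_eq_fun (ΘK (e n)).2.1.measurable (ΘG ⟨g, hg⟩).2.1.measurable
  -- On `B n` the element $u^{-1}g$ fixes points, so $u^*g1_{B_n}\in A$. Hence `T`, which commutes
  -- with `K` and `A`, commutes with $g1_{B_n}=u(u^*g1_{B_n})$.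
  have hzero : ∀ n, (T * normalizerIn.op g - normalizerIn.op g * T) *
      (φ.proj (B n) : H →L[ℂ] H) = 0 := by
    intro n
    set u : normalizerIn M A := (e n : normalizerIn M A) with hu
    set p : H →L[ℂ] H := (φ.proj (B n) : H →L[ℂ] H) with hp
    have hmem : normalizerIn.op (u⁻¹ * g) * p ∈ A := by
      refine hA.op_mul_proj_mem (hK.realizes_inv_mul hG (e n) ⟨g, hg⟩) (hB n) fun t ht => ?_
      rw [Equiv.symm_apply_eq]
      exact Eq.symm ht
    have hgp : normalizerIn.op g * p = normalizerIn.op u * (normalizerIn.op (u⁻¹ * g) * p) := by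
      have : normalizerIn.op (u⁻¹ * g) = star (normalizerIn.op u) * normalizerIn.op g := rfl
      rw [this, ← mul_assoc, ← mul_assoc, op_mul_star_op, one_mul]
    have hTu := hT (normalizerIn.op u) (Or.inl ⟨u, (e n).2, rfl⟩)
    have hTq := hT _ (Or.inr hmem)
    have hTp : p * T = T * p := hT p (Or.inr (φ.proj (B n)).2)
    rw [sub_mul, sub_eq_zero]
    calc T * normalizerIn.op g * p = T * (normalizerIn.op g * p) := mul_assoc _ _ _
      _ = (T * normalizerIn.op u) * (normalizerIn.op (u⁻¹ * g) * p) := by rw [hgp, mul_assoc]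
      _ = normalizerIn.op u * ((normalizerIn.op (u⁻¹ * g) * p) * T) := by
          rw [← hTu, mul_assoc, hTq]
      _ = (normalizerIn.op g * p) * T := by rw [hgp, mul_assoc, mul_assoc, mul_assoc]
      _ = normalizerIn.op g * T * p := by rw [mul_assoc, hTp, mul_assoc]
  have hU : φ.proj (⋃ n, B n) = 1 := by
    rw [← φ.proj_univ, φ.proj_eq_proj_iff (.iUnion hB) MeasurableSet.univ, ae_eq_univ]
    refine measure_mono_null ?_ (ae_iff.1 (weaklyContained_orbitRelation_iff.1 h ⟨g, hg⟩))
    intro t ht hmem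
    obtain ⟨u, hu⟩ := mem_orbitRelation.1 hmem
    obtain ⟨n, rfl⟩ := he u
    exact ht (Set.mem_iUnion.2 ⟨n, hu⟩)
  have := φ.mul_proj_iUnion_eq_zero hB hzero
  rw [hU] at this
  exact sub_eq_zero.1 (by simpa using this)

end Comparison

end

theorem proposition1p1
    {H : Type*} [NormedAddCommGroup H] [InnerProductSpace ℂ H] [CompleteSpace H]
    (M A : VonNeumannAlgebra H) (hM : HasSeparablePredual M)
    (τ : M.toStarSubalgebra →L[ℂ] ℂ) (hτ : IsFaithfulNormalTrace τ)
    (hA : IsMASA A M)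
    {Y : Type*} [MeasurableSpace Y] [StandardBorelSpace Y]
    (ν : MeasureTheory.Measure Y) [MeasureTheory.IsProbabilityMeasure ν]
    (φ : LInftyIso A ν) :
    -- a countable subgroup generating the same von Neumann algebra as the normalizer exists
    (∃ G : Subgroup (normalizerIn M A), Countable G ∧
      bicommutant (opSet G) = bicommutant (opSet (⊤ : Subgroup (normalizerIn M A)))) ∧
    -- the actions that define the orbit relations exist
    (∀ K : Subgroup (normalizerIn M A), Countable K →
      ∃ Θ : K →* classPreservingAut ν, Implements φ Θ) ∧
    -- comparison of the orbit relations, for every choice of `G` and of the actions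
    (∀ G : Subgroup (normalizerIn M A), Countable G →
      bicommutant (opSet G) = bicommutant (opSet (⊤ : Subgroup (normalizerIn M A))) →
      ∀ ΘG : G →* classPreservingAut ν, Implements φ ΘG →
      ∀ K : Subgroup (normalizerIn M A), Countable K →
      ∀ ΘK : K →* classPreservingAut ν, Implements φ ΘK →
        WeaklyContained ν (orbitRelation ΘK) (orbitRelation ΘG) ∧
        (WeaklyEquivalent ν (orbitRelation ΘK) (orbitRelation ΘG) ↔
          bicommutant (opSet K ∪ (A : Set (H →L[ℂ] H))) =
            bicommutant (opSet (⊤ : Subgroup (normalizerIn M A))))) := by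
  have : Nonempty Y := nonempty_of_isProbabilityMeasure ν
  refine ⟨exists_countable_bicommutant_eq hM, fun K hK => exists_implements φ K, ?_⟩
  intro G hG hGgen ΘG hΘG K hK ΘK hΘK
  -- This puts `A` inside the von Neumann algebra of the normalizer, so adjoining `A` to `K` never
  -- generates too much.
  have hAtop := subset_bicommutant_opSet_top (M := M) hA.prop.1 hA.prop.2
  have hKG : WeaklyContained ν (orbitRelation ΘK) (orbitRelation ΘG) := by
    refine weaklyContained_of_subset_bicommutant hτ hA.prop.1 hΘG hΘK ?_
    exact ((subset_bicommutant _).trans hGgen.ge).trans (bicommutant_mono Set.subset_union_left)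
  refine ⟨hKG, fun h => Set.Subset.antisymm ?_ ?_, fun h => ⟨hKG, ?_⟩⟩
  · exact bicommutant_subset_iff.2 (Set.union_subset
      ((opSet_mono le_top).trans (subset_bicommutant _)) hAtop)
  · rw [← hGgen]
    exact bicommutant_subset_iff.2
      (opSet_subset_bicommutant_of_weaklyContained hA hΘK hΘG h.2)
  · exact weaklyContained_of_subset_bicommutant hτ hA.prop.1 hΘK hΘG
      ((subset_bicommutant _).trans h.ge)
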